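/- Let $n\ge 0$. A polynomial $f\in\mathbb C[z_1,\dots,z_n]$ is called stable if $f(z_1,\dots,z_n)\neq 0$ for all $(z_1,\dots,z_n)\in\mathbb C^n$ with $\operatorname{Im} z_j>0$ for every $j$; a stable polynomial with real coefficients is called real stable. Let $A_n[\mathbb R]$ be the set of linear differential operators $T=\sum_{\alpha,\beta\in\mathbb N^n}a_{\alpha\beta}z^\alpha\partial^\beta$ with $a_{\alpha\beta}\in\mathbb R$, only finitely many of them nonzero (these coefficients are uniquely determined by $T$), and let $F_T(z,w)=\sum_{\alpha,\beta}a_{\alpha\beta}z^\alpha w^\beta\in\mathbb R[z_1,\dots,z_n,w_1,\dots,w_n]$ be the symbol of $T$. Theorem 1.3. Let $T\in A_n[\mathbb R]$. Then $T$ is nonzero and maps every real stable polynomial in $n$ variables to a real stable polynomial or to $0$ if and only if $F_T(z,-w)$ is a real stable polynomial in the $2n$ variables $z_1,\dots,z_n,w_1,\dots,w_n$. -/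

import Mathlib

open MvPolynomial

noncomputable section

namespace StabilityPreservers

/-- A complex polynomial is stable if it has no zero all of whose coordinates lie in the open
upper half-plane. -/
def IsStable {σ : Type*} (f : MvPolynomial σ ℂ) : Prop :=
  ∀ z : σ → ℂ, (∀ i, 0 < (z i).im) → eval z f ≠ 0

/-- A real polynomial is real stable if it is stable as a polynomial with complex coefficients. -/
def IsRealStable {σ : Type*} (f : MvPolynomial σ ℝ) : Prop :=
  IsStable (map (algebraMap ℝ ℂ) f)

/-- The monomial operator `∂^β = ∂₁^β₁ ⋯ ∂ₙ^βₙ` on `ℝ[z₁, …, zₙ]`. -/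
def partialPow {n : ℕ} (β : Fin n →₀ ℕ) : Module.End ℝ (MvPolynomial (Fin n) ℝ) :=
  ((List.finRange n).map fun i => (pderiv i).toLinearMap ^ β i).prod

/-- The operator `z^α ∂^β`: differentiate, then multiply by the monomial `z^α`. -/
def monomialOp {n : ℕ} (α β : Fin n →₀ ℕ) : Module.End ℝ (MvPolynomial (Fin n) ℝ) :=
  LinearMap.mulLeft ℝ (monomial α 1) * partialPow β

/-- The differential operator `∑ a_{αβ} z^α ∂^β` with finitely supported coefficients `a`. -/
def diffOp (n : ℕ) :
    (((Fin n →₀ ℕ) × (Fin n →₀ ℕ)) →₀ ℝ) →ₗ[ℝ] Module.End ℝ (MvPolynomial (Fin n) ℝ) :=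
  Finsupp.linearCombination ℝ fun p => monomialOp p.1 p.2

/-- The real Weyl algebra `A_n[ℝ]`, as the space of all finite order linear differential operators
with real polynomial coefficients. -/
def weylAlgebra (n : ℕ) : Submodule ℝ (Module.End ℝ (MvPolynomial (Fin n) ℝ)) :=
  LinearMap.range (diffOp n)

theorem pderiv_pow_monomial {n : ℕ} (i : Fin n) (k : ℕ) (γ : Fin n →₀ ℕ) (c : ℝ) :
    ((pderiv i).toLinearMap ^ k : Module.End ℝ (MvPolynomial (Fin n) ℝ)) (monomial γ c) =
      monomial (γ - Finsupp.single i k) (c * ((γ i).descFactorial k : ℝ)) := by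
  induction k with
  | zero => simp
  | succ k ih =>
    rw [pow_succ', Module.End.mul_apply, ih]
    rw [Derivation.coeFn_coe, pderiv_monomial, tsub_tsub, ← Finsupp.single_add]
    congr 1
    simp [Nat.descFactorial_succ]
    ring

theorem partialList_monomial {n : ℕ} (β γ : Fin n →₀ ℕ) (c : ℝ) (l : List (Fin n))
    (hl : l.Nodup) :
    ((l.map fun i => (pderiv i).toLinearMap ^ β i).prod :
        Module.End ℝ (MvPolynomial (Fin n) ℝ)) (monomial γ c) =
      monomial (γ - (l.map fun i => Finsupp.single i (β i)).sum)
        (c * (l.map fun i => ((γ i).descFactorial (β i) : ℝ)).prod) := by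
  induction l with
  | nil => simp
  | cons i l ih =>
    rw [List.nodup_cons] at hl
    have h0 : ((l.map fun j => Finsupp.single j (β j)).sum : Fin n →₀ ℕ) i = 0 := by
      have : ∀ l : List (Fin n), i ∉ l →
          ((l.map fun j => Finsupp.single j (β j)).sum : Fin n →₀ ℕ) i = 0 := by
        intro l
        induction l with
        | nil => simp
        | cons j l ih =>
          intro h
          rw [List.mem_cons, not_or] at h
          simp [ih h.2, Ne.symm h.1]
      exact this l hl.1
    rw [List.map_cons, List.prod_cons, Module.End.mul_apply, ih hl.2, pderiv_pow_monomial]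
    congr 1
    · simp only [List.map_cons, List.sum_cons]
      rw [tsub_tsub, add_comm]
    · simp only [List.map_cons, List.prod_cons, Finsupp.tsub_apply, h0, tsub_zero]
      ring

theorem partialPow_monomial_eq_zero {n : ℕ} {β γ : Fin n →₀ ℕ} (h : ¬ β ≤ γ) :
    partialPow β (monomial γ (1 : ℝ)) = 0 := by
  obtain ⟨i, hi⟩ : ∃ i, γ i < β i := by simpa [Finsupp.le_def] using h
  rw [partialPow, partialList_monomial _ _ _ _ (List.nodup_finRange n)]
  rw [show ((List.finRange n).map fun i => ((γ i).descFactorial (β i) : ℝ)).prod = 0 from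
    List.prod_eq_zero (List.mem_map.2 ⟨i, List.mem_finRange i, by
      simpa [Nat.descFactorial_eq_zero_iff_lt] using hi⟩)]
  simp

theorem partialPow_monomial_self {n : ℕ} (β : Fin n →₀ ℕ) :
    ∃ c : ℝ, c ≠ 0 ∧ partialPow β (monomial β (1 : ℝ)) = C c := by
  refine ⟨((List.finRange n).map fun i => ((β i).descFactorial (β i) : ℝ)).prod, ?_, ?_⟩
  · apply List.prod_ne_zero
    simp
  · rw [partialPow, partialList_monomial _ _ _ _ (List.nodup_finRange n)]
    have : ((List.finRange n).map fun i => Finsupp.single i (β i)).sum = β := by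
      rw [← Fin.sum_univ_def]
      exact Finsupp.univ_sum_single β
    rw [this, tsub_self, one_mul]
    rfl

/-- Uniqueness of the representation `T = ∑ a_{αβ} z^α ∂^β`. -/
theorem diffOp_injective (n : ℕ) : Function.Injective (diffOp n) := by
  rw [injective_iff_map_eq_zero]
  intro a ha
  by_contra hne
  obtain ⟨p, hp, hmin⟩ := a.support.exists_min_image (fun p => p.2.degree)
    (Finsupp.support_nonempty_iff.2 hne)
  obtain ⟨c, hc, hpc⟩ := partialPow_monomial_self p.2
  have h := congrArg (fun T : Module.End ℝ (MvPolynomial (Fin n) ℝ) =>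
    coeff p.1 (T (monomial p.2 1))) ha
  simp only [diffOp, Finsupp.linearCombination_apply, Finsupp.sum, LinearMap.sum_apply,
    LinearMap.smul_apply, coeff_sum, coeff_smul, monomialOp, Module.End.mul_apply,
    LinearMap.mulLeft_apply, LinearMap.zero_apply, coeff_zero] at h
  rw [Finset.sum_eq_single p] at h
  · rw [hpc, mul_comm, coeff_C_mul, coeff_monomial, if_pos rfl] at h
    simp [hc, Finsupp.mem_support_iff.1 hp] at h
  · intro q hq hqp
    by_cases hβ : q.2 ≤ p.2
    · have hβ' : q.2 = p.2 := by
        by_contra hlt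
        have h1 := hmin q hq
        obtain ⟨d, hd⟩ := exists_add_of_le hβ
        have h2 : p.2.degree = q.2.degree + d.degree := by rw [hd, map_add]
        have h3 : d.degree = 0 := by omega
        rw [Finsupp.degree_eq_zero_iff] at h3
        apply hlt
        rw [hd, h3, add_zero]
      have hα : q.1 ≠ p.1 := fun h => hqp (Prod.ext h hβ')
      rw [hβ', hpc, mul_comm, coeff_C_mul, coeff_monomial, if_neg hα]
      simp
    · rw [partialPow_monomial_eq_zero hβ]
      simp
  · intro h
    exact absurd hp h

/-- The coefficients `a_{αβ}` of the unique representation `T = ∑ a_{αβ} z^α ∂^β`. -/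
def opCoeff {n : ℕ} (T : weylAlgebra n) : ((Fin n →₀ ℕ) × (Fin n →₀ ℕ)) →₀ ℝ :=
  (LinearEquiv.ofInjective (diffOp n) (diffOp_injective n)).symm T

theorem diffOp_opCoeff {n : ℕ} (T : weylAlgebra n) :
    diffOp n (opCoeff T) = (T : Module.End ℝ (MvPolynomial (Fin n) ℝ)) :=
  congrArg Subtype.val
    ((LinearEquiv.ofInjective (diffOp n) (diffOp_injective n)).apply_symm_apply T)

/-- The symbol `F_T(z, w) = ∑ a_{αβ} z^α w^β`, a polynomial in the `2n` variables `zᵢ` (indexed by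
`Sum.inl i`) and `wᵢ` (indexed by `Sum.inr i`). -/
def symbol {n : ℕ} (T : weylAlgebra n) : MvPolynomial (Fin n ⊕ Fin n) ℝ :=
  (opCoeff T).sum fun p a =>
    C a * ((∏ i, X (Sum.inl i) ^ p.1 i) * ∏ i, X (Sum.inr i) ^ p.2 i)

/-- The substitution `F(z, w) ↦ F(z, -w)`. -/
def negW {n : ℕ} (F : MvPolynomial (Fin n ⊕ Fin n) ℝ) : MvPolynomial (Fin n ⊕ Fin n) ℝ :=
  aeval (Sum.elim (fun i => X (Sum.inl i)) fun i => -X (Sum.inr i)) F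

/-- The set `A_n(ℝ)` of real stability preservers: nonzero operators in `A_n[ℝ]` that map every
real stable polynomial to a real stable polynomial or to `0`. -/
def realStabilityPreservers (n : ℕ) : Set (weylAlgebra n) :=
  {T | T ≠ 0 ∧ ∀ f : MvPolynomial (Fin n) ℝ, IsRealStable f →
    IsRealStable ((T : Module.End ℝ (MvPolynomial (Fin n) ℝ)) f) ∨
      (T : Module.End ℝ (MvPolynomial (Fin n) ℝ)) f = 0}

end StabilityPreservers

end

open MvPolynomial

noncomputable section

namespace StabilityPreservers

/-! ### Univariate polynomials with no zeros in a half-plane or a disc. -/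

section Univariate

/-! Write `F` for the symbol of `T`.

Sufficiency is a Lieb-Sokal argument. If `F(z, -w)` and `f` are stable, so is `F(z, -w) f(u)` in
`3n` variables. Replacing each `wᵢ` by `-∂/∂uᵢ` preserves stability up to the zero polynomial, and
setting `u = z` then gives `T f`. A replacement is a chain of polar derivatives: Laguerre's theorem
(`eval_add_polar_ne_zero`) keeps each one zero-free, and `IsStableOrZero.sub_pderiv` turns its pole
into `-∂`.

Necessity tests `T` on approximations `E_w` of `exp(-w·z)`. For `w` in the upper half-plane and `|c|
= 1`, the polynomial `c E_w + c̄ E_w̄` is real stable, so its image is stable or zero. Hence the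
moduli of `T E_w` and `T E_w̄` cannot cross in the upper half-plane (`isStable_of_pencil`). If `F(·,
-w) ≠ 0`, exponential growth makes the first dominate at some point, so `T E_w` is stable. Dividing
out linear factors and passing to the limit by Hurwitz' theorem, `F(·, -w)` is stable.

It remains to exclude that `F(·, -w)` vanishes identically for some such `w` while `F ≠ 0`. The
operator `f ↦ T(zⱼ f)` is again a preserver, with symbol `zⱼ F + ∂F/∂wⱼ`. The dichotomy "stable or
zero" for both symbols, followed for small changes of `wⱼ` while `z` tends to infinity along a ray,
is contradictory unless `F(·, -w)` stays zero as `wⱼ` varies (`bivariate_eq_zero`). -/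

theorem norm_multiset_sum_add_le (M : Multiset ℂ) (c : ℂ) (ρ : ℝ) (h : ∀ ζ ∈ M, ‖ζ + c‖ ≤ ρ) :
    ‖M.sum + M.card * c‖ ≤ M.card * ρ := by
  induction M using Multiset.induction_on with
  | empty => simp
  | cons a M ih =>
    have h1 := ih fun ζ hζ => h ζ (Multiset.mem_cons_of_mem hζ)
    have h2 := h a (Multiset.mem_cons_self a M)
    have : (a ::ₘ M).sum + ((a ::ₘ M).card : ℂ) * c = (M.sum + M.card * c) + (a + c) := by
      simp; ring
    rw [this]
    refine (norm_add_le _ _).trans ?_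
    push_cast [Multiset.card_cons]
    linarith

/-- The condition on `ζ` describes the disc with centre `-i/(2η)` and radius `1/(2η)`. A sum of `m`
of its points lies in the disc scaled by `m`. -/
theorem sq_norm_multiset_sum_le {M : Multiset ℂ} {η : ℝ} (hη : 0 < η)
    (h : ∀ ζ ∈ M, η * ‖ζ‖ ^ 2 ≤ -ζ.im) : η * ‖M.sum‖ ^ 2 ≤ M.card * (-M.sum.im) := by
  have key : ∀ (ζ : ℂ) (m : ℝ), ‖ζ + m * (Complex.I / (2 * η))‖ ^ 2 =
      ‖ζ‖ ^ 2 + m / η * ζ.im + (m * (1 / (2 * η))) ^ 2 := by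
    intro ζ m
    have : (m : ℂ) * (Complex.I / (2 * η)) = ((m / (2 * η) : ℝ) : ℂ) * Complex.I := by
      push_cast; ring
    rw [this, Complex.sq_norm, Complex.sq_norm, Complex.normSq_apply, Complex.normSq_apply]
    simp only [Complex.add_re, Complex.add_im, Complex.re_ofReal_mul, Complex.im_ofReal_mul,
      Complex.I_re, Complex.I_im]
    field_simp
    ring
  have h1 := norm_multiset_sum_add_le M (Complex.I / (2 * η)) (1 / (2 * η)) fun ζ hζ => by
    refine le_of_sq_le_sq ?_ (by positivity)
    have := key ζ 1
    simp only [Complex.ofReal_one, one_mul] at this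
    rw [this]
    have h2 := h ζ hζ
    have : ‖ζ‖ ^ 2 + 1 / η * ζ.im ≤ 0 := by
      have : ‖ζ‖ ^ 2 + 1 / η * ζ.im = (η * ‖ζ‖ ^ 2 + ζ.im) / η := by field_simp
      rw [this]
      exact div_nonpos_of_nonpos_of_nonneg (by linarith) hη.le
    linarith
  have h2 := pow_le_pow_left₀ (norm_nonneg _) h1 2
  have h3 := key M.sum M.card
  rw [Complex.ofReal_natCast] at h3
  rw [h3] at h2
  have h4 : ‖M.sum‖ ^ 2 + M.card / η * M.sum.im = (η * ‖M.sum‖ ^ 2 + M.card * M.sum.im) / η := by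
    field_simp
  have h5 : (η * ‖M.sum‖ ^ 2 + M.card * M.sum.im) / η ≤ 0 := by rw [← h4]; linarith
  rw [div_le_iff₀ hη] at h5
  linarith

/-- The logarithmic derivative at 0 is the sum of `-1/r` over the roots `r`. Since `Im r ≤ -η`,
inversion puts each term in the disc of the previous lemma. -/
theorem sq_norm_logDeriv_le {q : Polynomial ℂ} {d : ℕ} {η : ℝ} (hη : 0 < η)
    (hd : q.natDegree ≤ d) (hq : ∀ t : ℂ, -η < t.im → q.eval t ≠ 0) :
    η * ‖q.derivative.eval 0 / q.eval 0‖ ^ 2 ≤ d * -(q.derivative.eval 0 / q.eval 0).im := by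
  have h0 : q.eval 0 ≠ 0 := hq 0 (by simpa using hη)
  have hs := IsAlgClosed.splits q
  rw [hs.eval_derivative_div_eval_of_ne_zero h0]
  have h1 := sq_norm_multiset_sum_le (M := q.roots.map fun z => 1 / (0 - z)) hη (by
    intro ζ hζ
    obtain ⟨r, hr, rfl⟩ := Multiset.mem_map.1 hζ
    have hr0 : q.eval r = 0 := (Polynomial.mem_roots'.1 hr).2
    have hri : r.im ≤ -η := by
      by_contra hc
      exact hq r (not_le.1 hc) hr0
    have hrne : r ≠ 0 := by
      rintro rfl
      exact h0 hr0
    have hn : 0 < Complex.normSq r := Complex.normSq_pos.2 hrne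
    rw [Complex.sq_norm, zero_sub, one_div, Complex.normSq_inv, Complex.normSq_neg,
      Complex.inv_im, Complex.normSq_neg, Complex.neg_im, neg_neg, ← div_eq_mul_inv, ← neg_div]
    gcongr
    linarith)
  refine h1.trans ?_
  have h2 : ((q.roots.map fun z => 1 / (0 - z)).card : ℝ) ≤ d := by
    rw [Multiset.card_map]
    exact_mod_cast (Polynomial.card_roots' q).trans hd
  rcases Nat.eq_zero_or_pos (q.roots.map fun z => 1 / (0 - z)).card with h | h
  · rw [Multiset.card_eq_zero] at h
    rw [h]
    simp
  · refine mul_le_mul_of_nonneg_right h2 ?_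
    have : 0 ≤ η * ‖(q.roots.map fun z => 1 / (0 - z)).sum‖ ^ 2 := by positivity
    have hp : (0 : ℝ) < ((q.roots.map fun z => 1 / (0 - z)).card : ℝ) := by exact_mod_cast h
    exact nonneg_of_mul_nonneg_right (this.trans h1) hp

/-- Laguerre's theorem on polar derivatives, for a half-plane. -/
theorem eval_add_polar_ne_zero {q : Polynomial ℂ} {d : ℕ} {η : ℝ} (hη : 0 < η) (hd0 : d ≠ 0)
    (hd : q.natDegree ≤ d) (hq : ∀ t : ℂ, -η < t.im → q.eval t ≠ 0) {s : ℂ} (hs : -η < s.im) :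
    q.eval 0 + s / d * q.derivative.eval 0 ≠ 0 := by
  intro h
  have h0 : q.eval 0 ≠ 0 := hq 0 (by simpa using hη)
  have hdc : (d : ℂ) ≠ 0 := by exact_mod_cast hd0
  have hdr : (0 : ℝ) < d := by exact_mod_cast Nat.pos_of_ne_zero hd0
  have hs0 : s ≠ 0 := by
    rintro rfl
    simp [h0] at h
  -- A zero of the polar derivative forces this logarithmic derivative, and the disc inequality then
  -- reads `η ≤ -Im s`.
  have hS : q.derivative.eval 0 / q.eval 0 = -(d * s⁻¹) := by
    field_simp
    field_simp at h
    linear_combination h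
  have h1 := sq_norm_logDeriv_le hη hd hq
  have hn : 0 < Complex.normSq s := Complex.normSq_pos.2 hs0
  rw [hS, norm_neg, Complex.sq_norm, Complex.normSq_mul, Complex.normSq_inv,
    Complex.normSq_natCast, Complex.neg_im, neg_neg,
    ← Complex.ofReal_natCast, Complex.im_ofReal_mul, Complex.inv_im] at h1
  have h2 : η * (d * d * (Complex.normSq s)⁻¹) * (Complex.normSq s / (d * d)) = η := by
    field_simp
  have h3 : d * (d * (-s.im / Complex.normSq s)) * (Complex.normSq s / (d * d)) = -s.im := by
    field_simp
  have h4 := mul_le_mul_of_nonneg_right h1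
    (show 0 ≤ Complex.normSq s / ((d : ℝ) * d) by positivity)
  rw [h2, h3] at h4
  linarith

/-- Every root has modulus at least `δ`, so each linear factor grows by at most `1 + 1/δ` between 0
and 1. The constant depends on `q` only through the degree bound, which makes this a Harnack
inequality. -/
theorem norm_eval_one_le {q : Polynomial ℂ} {D : ℕ} {δ : ℝ} (hδ : 0 < δ)
    (hD : q.natDegree ≤ D) (hq : ∀ t : ℂ, ‖t‖ < δ → q.eval t ≠ 0) :
    ‖q.eval 1‖ ≤ (1 + 1 / δ) ^ D * ‖q.eval 0‖ := by
  have hs := IsAlgClosed.splits q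
  rw [hs.eval_eq_prod_roots, hs.eval_eq_prod_roots, norm_mul, norm_mul, mul_left_comm]
  refine mul_le_mul_of_nonneg_left ?_ (norm_nonneg _)
  have h1 : (1 : ℝ) ≤ 1 + 1 / δ := by
    have : 0 < 1 / δ := by positivity
    linarith
  have key : ∀ M : Multiset ℂ, (∀ r ∈ M, δ ≤ ‖r‖) →
      ‖(M.map fun a => 1 - a).prod‖ ≤ (1 + 1 / δ) ^ M.card * ‖(M.map fun a => 0 - a).prod‖ := by
    intro M
    induction M using Multiset.induction_on with
    | empty => simp
    | cons a M ih =>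
      intro h
      have ha := h a (Multiset.mem_cons_self a M)
      have ih := ih fun r hr => h r (Multiset.mem_cons_of_mem hr)
      rw [Multiset.map_cons, Multiset.map_cons, Multiset.prod_cons, Multiset.prod_cons, norm_mul,
        norm_mul, Multiset.card_cons, pow_succ]
      have h2 : ‖1 - a‖ ≤ (1 + 1 / δ) * ‖0 - a‖ := by
        rw [zero_sub, norm_neg, add_mul, one_mul]
        have : 1 ≤ 1 / δ * ‖a‖ := by
          rw [one_div, ← div_eq_inv_mul, le_div_iff₀ hδ]
          linarith
        calc ‖1 - a‖ ≤ ‖(1 : ℂ)‖ + ‖a‖ := norm_sub_le _ _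
          _ ≤ _ := by rw [norm_one]; linarith
      calc _ ≤ ((1 + 1 / δ) * ‖0 - a‖) *
          ((1 + 1 / δ) ^ M.card * ‖(M.map fun a => 0 - a).prod‖) := by gcongr
        _ = _ := by ring
  refine (key q.roots ?_).trans ?_
  · intro r hr
    by_contra hc
    exact hq r (not_le.1 hc) (Polynomial.mem_roots'.1 hr).2
  · refine mul_le_mul_of_nonneg_right ?_ (norm_nonneg _)
    exact pow_le_pow_right₀ h1 ((Polynomial.card_roots' q).trans hD)

/-- The logarithmic derivative at 0 has at most `D` terms, each of modulus at most `1/δ`. -/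
theorem norm_derivative_eval_zero_le {q : Polynomial ℂ} {D : ℕ} {δ : ℝ} (hδ : 0 < δ)
    (hD : q.natDegree ≤ D) (hq : ∀ t : ℂ, ‖t‖ < δ → q.eval t ≠ 0) :
    ‖q.derivative.eval 0‖ ≤ D / δ * ‖q.eval 0‖ := by
  have h0 : q.eval 0 ≠ 0 := hq 0 (by simpa using hδ)
  rw [(IsAlgClosed.splits q).eval_derivative_eq_eval_mul_sum h0, norm_mul, mul_comm]
  refine mul_le_mul_of_nonneg_right ?_ (norm_nonneg _)
  have h1 := norm_multiset_sum_add_le (q.roots.map fun z => 1 / (0 - z)) 0 (1 / δ) (by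
    intro ζ hζ
    obtain ⟨r, hr, rfl⟩ := Multiset.mem_map.1 hζ
    have : δ ≤ ‖r‖ := by
      by_contra hc
      exact hq r (not_le.1 hc) (Polynomial.mem_roots'.1 hr).2
    rw [add_zero, norm_div, norm_one, zero_sub, norm_neg]
    gcongr)
  rw [mul_zero, add_zero, Multiset.card_map] at h1
  refine h1.trans ?_
  rw [mul_one_div]
  gcongr
  exact (Polynomial.card_roots' q).trans hD

end Univariate

/-! ### Restriction of a multivariate polynomial to a line. -/

section Slice

variable {σ : Type*}

/-- The restriction `t ↦ p (x + t v)` of a polynomial to a line. -/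
def lineSlice (x v : σ → ℂ) : MvPolynomial σ ℂ →ₐ[ℂ] Polynomial ℂ :=
  aeval fun i => Polynomial.C (x i) + Polynomial.C (v i) * Polynomial.X

theorem eval_lineSlice (x v : σ → ℂ) (p : MvPolynomial σ ℂ) (t : ℂ) :
    (lineSlice x v p).eval t = eval (fun i => x i + v i * t) p := by
  rw [lineSlice, ← Polynomial.coe_evalRingHom, ← RingHom.coe_coe (aeval _), ← RingHom.comp_apply]
  congr 1
  apply MvPolynomial.ringHom_ext <;> intros <;> simp

theorem natDegree_lineSlice_le (x v : σ → ℂ) (p : MvPolynomial σ ℂ) :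
    (lineSlice x v p).natDegree ≤ p.totalDegree := by
  have := MvPolynomial.aeval_natDegree_le p le_rfl
    (fun i => Polynomial.C (x i) + Polynomial.C (v i) * Polynomial.X) (n := 1) (fun i => by
      compute_degree)
  simpa [lineSlice] using this

theorem derivative_lineSlice [DecidableEq σ] (x : σ → ℂ) (i : σ) (p : MvPolynomial σ ℂ) :
    (lineSlice x (Pi.single i 1) p).derivative = lineSlice x (Pi.single i 1) (pderiv i p) := by
  induction p using MvPolynomial.induction_on with
  | C a => simp [lineSlice]
  | add p q hp hq => simp [hp, hq]
  | mul_X p j hp =>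
    have hX : (lineSlice x (Pi.single i 1) (X j)).derivative =
        lineSlice x (Pi.single i 1) (pderiv i (X j)) := by
      by_cases h : j = i
      · subst h
        rw [pderiv_X_self]
        simp [lineSlice]
      · rw [pderiv_X_of_ne h]
        simp [lineSlice, Pi.single_eq_of_ne h]
    rw [map_mul, Polynomial.derivative_mul, hp, pderiv_mul, map_add, map_mul, map_mul, hX]

theorem natDegree_lineSlice_single_le [DecidableEq σ] (x : σ → ℂ) (i : σ) (p : MvPolynomial σ ℂ) :
    (lineSlice x (Pi.single i 1) p).natDegree ≤ p.degreeOf i := by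
  rw [lineSlice, aeval_def, eval₂_eq]
  refine Polynomial.natDegree_sum_le_of_forall_le _ _ fun m hm => ?_
  rw [Polynomial.algebraMap_apply]
  refine (Polynomial.natDegree_C_mul_le _ _).trans ((Polynomial.natDegree_prod_le _ _).trans ?_)
  refine le_trans ?_ ((degreeOf_le_iff.1 le_rfl) m hm)
  calc _ ≤ ∑ j ∈ m.support, if j = i then m i else 0 := by
        refine Finset.sum_le_sum fun j _ => ?_
        split_ifs with h
        · subst h
          refine Polynomial.natDegree_pow_le.trans ?_
          refine (Nat.mul_le_mul_left _ (?_ : _ ≤ 1)).trans (mul_one _).le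
          compute_degree
        · rw [Pi.single_eq_of_ne h, Polynomial.C_0, zero_mul, add_zero, ← Polynomial.C_pow,
            Polynomial.natDegree_C]
    _ ≤ m i := by
        rw [Finset.sum_ite_eq']
        split_ifs <;> simp

end Slice

/-! ### Hurwitz' theorem for stable polynomials. -/

section StableOrZero

variable {σ : Type*}

/-- A polynomial that is stable or identically zero. -/
def IsStableOrZero (p : MvPolynomial σ ℂ) : Prop :=
  IsStable p ∨ p = 0

theorem exists_pos_forall_norm_lt_im_pos [Finite σ] {x : σ → ℂ} (hx : ∀ i, 0 < (x i).im)
    (v : σ → ℂ) : ∃ δ : ℝ, 0 < δ ∧ ∀ t : ℂ, ‖t‖ < δ → ∀ i, 0 < (x i + v i * t).im := by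
  have hopen : IsOpen {t : ℂ | ∀ i, 0 < (x i + v i * t).im} := by
    simp only [Set.ofPred_forall]
    exact isOpen_iInter_of_finite fun i => isOpen_lt continuous_const
      (Complex.continuous_im.comp (by fun_prop))
  obtain ⟨δ, hδ, h⟩ := Metric.isOpen_iff.1 hopen 0 (by simpa using hx)
  exact ⟨δ, hδ, fun t ht => h (by simpa using ht)⟩

/-- The Harnack bound on the line from `x` to `y`. As `K` does not depend on `p`, it survives
limits: a limit that vanishes at one such `x` vanishes at every `y`. -/
theorem exists_norm_eval_le [Finite σ] {x : σ → ℂ} (hx : ∀ i, 0 < (x i).im) (y : σ → ℂ) (D : ℕ) :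
    ∃ K : ℝ, ∀ p : MvPolynomial σ ℂ, IsStableOrZero p → p.totalDegree ≤ D →
      ‖eval y p‖ ≤ K * ‖eval x p‖ := by
  obtain ⟨δ, hδ, h⟩ := exists_pos_forall_norm_lt_im_pos hx (y - x)
  refine ⟨(1 + 1 / δ) ^ D, fun p hp hD => ?_⟩
  rcases hp with hp | rfl
  · have := norm_eval_one_le (q := lineSlice x (y - x) p) hδ
      ((natDegree_lineSlice_le _ _ _).trans hD) (fun t ht => by
        rw [eval_lineSlice]
        exact hp _ (h t ht))
    rw [eval_lineSlice, eval_lineSlice] at this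
    simpa using this
  · simp

/-- Hurwitz' theorem for polynomials of bounded degree. -/
theorem IsStableOrZero.of_tendsto [Finite σ] {p : ℕ → MvPolynomial σ ℂ} {q : MvPolynomial σ ℂ}
    {D : ℕ} (hp : ∀ᶠ k in Filter.atTop, IsStableOrZero (p k) ∧ (p k).totalDegree ≤ D)
    (hlim : ∀ x, Filter.Tendsto (fun k => eval x (p k)) Filter.atTop (nhds (eval x q))) :
    IsStableOrZero q := by
  by_contra hc
  rw [IsStableOrZero, not_or, IsStable] at hc
  push Not at hc
  obtain ⟨⟨x, hx, hx0⟩, hq⟩ := hc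
  apply hq
  apply MvPolynomial.funext
  intro y
  obtain ⟨K, hK⟩ := exists_norm_eval_le hx y D
  have := le_of_tendsto_of_tendsto (hlim y).norm ((hlim x).norm.const_mul K)
    (hp.mono fun k hk => hK _ hk.1 hk.2)
  rw [hx0, norm_zero, mul_zero] at this
  simpa using this

theorem IsStableOrZero.of_perturb [Finite σ] {p q : MvPolynomial σ ℂ}
    (h : ∀ ε : ℝ, 0 < ε → IsStableOrZero (p + C (ε * Complex.I) * q)) : IsStableOrZero p := by
  refine IsStableOrZero.of_tendsto (D := max p.totalDegree q.totalDegree)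
    (p := fun k : ℕ => p + C (((1 / ((k : ℝ) + 1) : ℝ) : ℂ) * Complex.I) * q)
    (Filter.Eventually.of_forall fun k => ⟨h _ (by positivity), ?_⟩) fun x => ?_
  · refine (totalDegree_add _ _).trans (max_le_max le_rfl ((totalDegree_mul _ _).trans ?_))
    rw [totalDegree_C, zero_add]
  · simp only [map_add, map_mul, eval_C]
    have : Filter.Tendsto (fun k : ℕ => ((1 / ((k : ℝ) + 1) : ℝ) : ℂ)) Filter.atTop (nhds 0) := by
      have := (Complex.continuous_ofReal.tendsto 0).comp
        (tendsto_one_div_add_atTop_nhds_zero_nat (𝕜 := ℝ))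
      simpa only [Complex.ofReal_zero, Function.comp_def] using this
    simpa using ((this.mul_const Complex.I).mul_const (eval x q)).const_add (eval x p)

theorem IsStableOrZero.const_mul {p : MvPolynomial σ ℂ} (hp : IsStableOrZero p) (c : ℂ) :
    IsStableOrZero (C c * p) := by
  rcases eq_or_ne c 0 with rfl | hc
  · exact Or.inr (by simp)
  · rcases hp with hp | rfl
    · exact Or.inl fun z hz => by simpa [hc] using hp z hz
    · exact Or.inr (by simp)

end StableOrZero

/-! ### The Lieb-Sokal lemma, by way of polar derivatives. -/

section LiebSokal

variable {σ : Type*}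

/-- The Lieb-Sokal lemma for polynomials of degree at most one in the extra variable. -/
theorem IsStableOrZero.sub_pderiv [Finite σ] {P Q : MvPolynomial σ ℂ} (j : σ)
    (h : ∀ x : σ → ℂ, (∀ i, 0 < (x i).im) → ∀ s : ℂ, 0 < s.im → eval x P + s * eval x Q ≠ 0) :
    IsStableOrZero (P - pderiv j Q) := by
  classical
  have hQ : IsStableOrZero Q := by
    refine IsStableOrZero.of_perturb (q := -P) fun ε hε => ?_
    -- Up to a constant, `Q - iεP` is `P + sQ` at `s = i/ε`; so `Q` arises as `s` goes to `i∞`.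
    have : Q + C (ε * Complex.I) * (-P) =
        C (-(ε * Complex.I)) * (P + C ((ε⁻¹ : ℝ) * Complex.I) * Q) := by
      rw [mul_add, ← mul_assoc, ← C_mul]
      have : -(ε * Complex.I) * ((ε⁻¹ : ℝ) * Complex.I) = 1 := by
        have : (ε : ℂ) ≠ 0 := by exact_mod_cast hε.ne'
        push_cast
        field_simp
        simp
      rw [this, C_neg, C_1]
      ring
    rw [this]
    refine IsStableOrZero.const_mul (Or.inl fun z hz => ?_) _
    simpa using h z hz ((ε⁻¹ : ℝ) * Complex.I) (by
      rw [Complex.im_ofReal_mul]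
      simpa using hε)
  rcases hQ with hQ | rfl
  · refine IsStableOrZero.of_perturb (q := Q) fun ε hε => Or.inl fun x hx h0 => ?_
    have hQx := hQ x hx
    have h1 := sq_norm_logDeriv_le (q := lineSlice x (Pi.single j 1) Q) (hx j) le_rfl (by
      intro t ht
      rw [eval_lineSlice]
      refine hQ _ fun i => ?_
      by_cases hij : i = j
      · subst hij
        simp
        linarith
      · simpa [Pi.single_eq_of_ne hij] using hx i)
    rw [derivative_lineSlice, eval_lineSlice, eval_lineSlice] at h1
    simp only [mul_zero, add_zero] at h1
    -- With `Im S ≤ 0`, the perturbed value `P - ∂ⱼQ + iεQ` equals `P + sQ` at `s = iε - S`, which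
    -- lies in the upper half-plane.
    set S := eval x (pderiv j Q) / eval x Q with hS
    have h2 : 0 ≤ (-S.im) := by
      rcases Nat.eq_zero_or_pos (lineSlice x (Pi.single j 1) Q).natDegree with hd | hd
      · rw [hd] at h1
        have : ‖S‖ ^ 2 ≤ 0 := by
          have h3 := hx j
          by_contra hc
          have := mul_pos h3 (not_le.1 hc)
          simp at h1
          linarith
        have : S = 0 := by simpa using le_antisymm this (sq_nonneg _)
        simp [this]
      · refine nonneg_of_mul_nonneg_right (le_trans ?_ h1) (by exact_mod_cast hd)
        have := (hx j).le
        positivity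
    refine h x hx (ε * Complex.I - S) (by simp; linarith) ?_
    simp only [map_add, map_sub, map_mul, eval_C] at h0
    have h3 : S * eval x Q = eval x (pderiv j Q) := div_mul_cancel₀ _ hQx
    linear_combination h0 - h3
  · rw [map_zero, sub_zero]
    exact Or.inl fun x hx => by simpa using h x hx Complex.I (by simp)

/-- One step of the replacement of the variable `i` by `-∂ⱼ`. -/
def liebSokalStep (i j : σ) (d : ℕ) : Module.End ℂ (MvPolynomial σ ℂ) :=
  1 - (d : ℂ)⁻¹ • ((LinearMap.mulLeft ℂ (X i) + (pderiv j).toLinearMap) * (pderiv i).toLinearMap)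

theorem liebSokalStep_apply (i j : σ) (d : ℕ) (p : MvPolynomial σ ℂ) :
    liebSokalStep i j d p = p - C (d : ℂ)⁻¹ * (X i * pderiv i p + pderiv j (pderiv i p)) := by
  simp [liebSokalStep, smul_eq_C_mul, mul_add]

/-- The polar derivative `p + ((s - xᵢ)/d) ∂ᵢp` is nonzero for `Im s > 0` by Laguerre's theorem. It
is affine in `s`, so `s` may be replaced by `-∂ⱼ`. -/
theorem IsStableOrZero.liebSokalStep [Finite σ] {p : MvPolynomial σ ℂ} (hp : IsStableOrZero p)
    (i j : σ) {d : ℕ} (hd : d ≠ 0) (hpd : p.degreeOf i ≤ d) :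
    IsStableOrZero (liebSokalStep i j d p) := by
  classical
  rcases hp with hp | rfl
  · have : StabilityPreservers.liebSokalStep i j d p = (p - C (d : ℂ)⁻¹ * (X i * pderiv i p)) -
        pderiv j (C (d : ℂ)⁻¹ * pderiv i p) := by
      rw [liebSokalStep_apply, pderiv_C_mul]
      ring
    rw [this]
    refine IsStableOrZero.sub_pderiv j fun x hx s hs => ?_
    have h1 := eval_add_polar_ne_zero (q := lineSlice x (Pi.single i 1) p) (hx i) hd
      ((natDegree_lineSlice_single_le x i p).trans hpd) (by
      intro t ht
      rw [eval_lineSlice]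
      refine hp _ fun k => ?_
      by_cases hik : k = i
      · subst hik
        simp
        linarith
      · simpa [Pi.single_eq_of_ne hik] using hx k) (s := s - x i) (by simpa using hs)
    rw [derivative_lineSlice, eval_lineSlice, eval_lineSlice] at h1
    simp only [mul_zero, add_zero] at h1
    convert h1 using 1
    simp
    ring
  · exact Or.inr (map_zero _)

theorem degreeOf_liebSokalStep_le (i j : σ) {d : ℕ} (hij : i ≠ j) {p : MvPolynomial σ ℂ}
    (hp : p.degreeOf i ≤ d + 1) : (liebSokalStep i j (d + 1) p).degreeOf i ≤ d := by
  classical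
  rw [degreeOf_le_iff] at hp ⊢
  have hc : ∀ m : σ →₀ ℕ, d + 1 < m i → coeff m p = 0 := fun m hm => by
    by_contra h
    have := hp m (mem_support_iff.2 h)
    omega
  intro m hm
  by_contra hlt
  rw [not_le] at hlt
  rw [mem_support_iff, liebSokalStep_apply] at hm
  apply hm
  rw [coeff_sub, coeff_C_mul, coeff_add, coeff_X_mul', coeff_pderiv, coeff_pderiv, coeff_pderiv,
    if_pos (by simp; omega)]
  have h1 : m - Finsupp.single i 1 + Finsupp.single i 1 = m := by
    ext k
    by_cases hk : k = i
    · subst hk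
      simp
      omega
    · simp [Finsupp.single_eq_of_ne hk]
  rw [h1, hc (m + Finsupp.single j 1 + Finsupp.single i 1) (by simp; omega)]
  -- In the top degree `d + 1` the coefficient is multiplied by `1 - (d + 1)/(d + 1) = 0`.
  rcases eq_or_ne (m i) (d + 1) with h | h
  · rw [Finsupp.tsub_apply, h]
    simp
    field_simp
    simp
  · rw [hc m (by omega)]
    simp

/-- The replacement of the variable `i` by `-∂ⱼ`, on polynomials of degree at most `d` in it. -/
def liebSokal (i j : σ) : ℕ → Module.End ℂ (MvPolynomial σ ℂ)
  | 0 => 1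
  | d + 1 => liebSokal i j d * liebSokalStep i j (d + 1)

theorem IsStableOrZero.liebSokal [Finite σ] {i j : σ} (hij : i ≠ j) {d : ℕ} :
    ∀ {p : MvPolynomial σ ℂ}, IsStableOrZero p → p.degreeOf i ≤ d →
      IsStableOrZero (liebSokal i j d p) := by
  induction d with
  | zero => intro p hp _; exact hp
  | succ d ih =>
    intro p hp hd
    exact ih (hp.liebSokalStep i j d.succ_ne_zero hd) (degreeOf_liebSokalStep_le i j hij hd)

/-- A step of order `d` sends `xᵢ^k M` to `(1 - k/d) xᵢ^k M - (k/d) xᵢ^(k-1) ∂ⱼM`. Inductively both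
monomials lead to the same `(-∂ⱼ)^k M`, and the weights add up to one. -/
theorem liebSokal_X_pow_mul {i j : σ} (hij : i ≠ j) {d : ℕ} :
    ∀ {k : ℕ} {M : MvPolynomial σ ℂ}, k ≤ d → pderiv i M = 0 →
      liebSokal i j d (X i ^ k * M) = (-1) ^ k * ((pderiv j).toLinearMap ^ k) M := by
  induction d with
  | zero =>
    intro k M hk _
    obtain rfl : k = 0 := by omega
    simp [liebSokal]
  | succ d ih =>
    intro k M hk hM
    rw [liebSokal, Module.End.mul_apply]
    rcases k with _ | k
    · have := ih (k := 0) (Nat.zero_le _) hM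
      simpa [liebSokalStep_apply, hM] using this
    · have hj : pderiv j (X i : MvPolynomial σ ℂ) = 0 := pderiv_X_of_ne hij
      have h1 : pderiv i (X i ^ (k + 1) * M) = C ((k + 1 : ℕ) : ℂ) * (X i ^ k * M) := by
        rw [pderiv_mul, hM, pderiv_pow, pderiv_X_self]
        simp
        ring
      have h2 : pderiv j (X i ^ k * M) = X i ^ k * pderiv j M := by
        rw [pderiv_mul, pderiv_pow, hj]
        simp
      have hMj : pderiv i (pderiv j M) = 0 := by
        have : pderiv i (pderiv j M) = pderiv j (pderiv i M) := by
          ext m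
          simp only [coeff_pderiv]
          rw [add_right_comm]
          simp [Finsupp.single_eq_of_ne hij, Finsupp.single_eq_of_ne hij.symm]
          ring
        rw [this, hM, map_zero]
      have h3 : liebSokalStep i j (d + 1) (X i ^ (k + 1) * M) =
          (1 - ((d + 1 : ℕ) : ℂ)⁻¹ * ((k + 1 : ℕ) : ℂ)) • (X i ^ (k + 1) * M) -
          (((d + 1 : ℕ) : ℂ)⁻¹ * ((k + 1 : ℕ) : ℂ)) • (X i ^ k * pderiv j M) := by
        rw [liebSokalStep_apply, h1, pderiv_C_mul, h2, smul_eq_C_mul, smul_eq_C_mul, C_sub,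
          C_mul, C_1]
        ring
      rw [h3, map_sub, map_smul, map_smul, ih (by omega) hMj]
      have h4 : ((pderiv j).toLinearMap ^ k) (pderiv j M) =
          ((pderiv j).toLinearMap ^ (k + 1)) M := by
        rw [pow_succ]
        rfl
      rw [h4]
      -- For the top exponent the induction hypothesis does not cover the first term, but its weight
      -- is zero.
      rcases Nat.lt_or_ge d (k + 1) with hlt | hge
      · obtain rfl : k = d := by omega
        have : ((k + 1 : ℕ) : ℂ)⁻¹ * ((k + 1 : ℕ) : ℂ) = 1 :=
          inv_mul_cancel₀ (by exact_mod_cast k.succ_ne_zero)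
        rw [this, sub_self, zero_smul, one_smul]
        ring
      · rw [ih hge hM, sub_smul, one_smul, pow_succ]
        simp only [smul_eq_C_mul]
        ring

end LiebSokal

/-! ### Algebra of iterated partial derivatives. -/

section IteratedDerivatives

variable {ι σ R : Type*} [CommRing R]

theorem pderiv_pderiv_comm (i j : σ) (p : MvPolynomial σ R) :
    pderiv i (pderiv j p) = pderiv j (pderiv i p) := by
  classical
  ext m
  simp only [coeff_pderiv]
  rw [add_right_comm]
  by_cases hij : i = j
  · rw [hij]
  · simp [Finsupp.single_eq_of_ne hij, Finsupp.single_eq_of_ne (Ne.symm hij)]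
    ring

/-- The composition of the operators `∂_{u i} ^ b i` over a list of indices `i`. -/
def derivList (u : ι → σ) (b : ι → ℕ) (l : List ι) : Module.End R (MvPolynomial σ R) :=
  (l.map fun i => (pderiv (u i)).toLinearMap ^ b i).prod

theorem pderiv_pow_const_mul {i : σ} {Q : MvPolynomial σ R} (hQ : pderiv i Q = 0) (k : ℕ)
    (M : MvPolynomial σ R) :
    ((pderiv i).toLinearMap ^ k : Module.End R (MvPolynomial σ R)) (Q * M) =
      Q * ((pderiv i).toLinearMap ^ k : Module.End R (MvPolynomial σ R)) M := by
  induction k with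
  | zero => rfl
  | succ k ih =>
    rw [pow_succ', Module.End.mul_apply, ih, Module.End.mul_apply, Derivation.coeFn_coe,
      pderiv_mul, hQ, zero_mul, zero_add]

theorem derivList_const_mul {u : ι → σ} {Q : MvPolynomial σ R} {l : List ι}
    (hQ : ∀ i ∈ l, pderiv (u i) Q = 0) (b : ι → ℕ) (M : MvPolynomial σ R) :
    derivList u b l (Q * M) = Q * derivList u b l M := by
  induction l with
  | nil => rfl
  | cons i l ih =>
    rw [List.forall_mem_cons] at hQ
    simp only [derivList, List.map_cons, List.prod_cons, Module.End.mul_apply] at ih ⊢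
    rw [ih hQ.2, pderiv_pow_const_mul hQ.1]

theorem pderiv_pderiv_pow_eq_zero {i j : σ} {M : MvPolynomial σ R} (hM : pderiv i M = 0) (k : ℕ) :
    pderiv i (((pderiv j).toLinearMap ^ k : Module.End R (MvPolynomial σ R)) M) = 0 := by
  induction k with
  | zero => exact hM
  | succ k ih =>
    rw [pow_succ', Module.End.mul_apply, Derivation.coeFn_coe, pderiv_pderiv_comm, ih, map_zero]

theorem pderiv_derivList_eq_zero {u : ι → σ} {i : σ} {M : MvPolynomial σ R} (hM : pderiv i M = 0)
    (b : ι → ℕ) (l : List ι) : pderiv i (derivList u b l M) = 0 := by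
  induction l with
  | nil => exact hM
  | cons j l ih =>
    simp only [derivList, List.map_cons, List.prod_cons, Module.End.mul_apply] at ih ⊢
    exact pderiv_pderiv_pow_eq_zero ih _

theorem rename_derivList {u : ι → σ} (hu : Function.Injective u) (b : ι → ℕ) (l : List ι)
    (p : MvPolynomial ι R) : rename u (derivList id b l p) = derivList u b l (rename u p) := by
  induction l with
  | nil => rfl
  | cons j l ih =>
    simp only [derivList, List.map_cons, List.prod_cons, Module.End.mul_apply] at ih ⊢
    rw [← ih]
    generalize ((l.map fun i => (pderiv (id i)).toLinearMap ^ b i).prod :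
      Module.End R (MvPolynomial ι R)) p = q
    induction b j with
    | zero => rfl
    | succ k ihk =>
      rw [pow_succ', Module.End.mul_apply, pow_succ', Module.End.mul_apply, ← ihk]
      exact (pderiv_rename hu _ _).symm

end IteratedDerivatives

/-! ### Replacing several variables by derivatives. -/

section LiebSokalList

variable {ι σ : Type*}

theorem degreeOf_liebSokalStep_le_of_ne {i j k : σ} (hki : k ≠ i) (d D : ℕ) {p : MvPolynomial σ ℂ}
    (hp : p.degreeOf k ≤ D) : (liebSokalStep i j d p).degreeOf k ≤ D := by
  classical
  rw [degreeOf_le_iff] at hp ⊢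
  have hc : ∀ m : σ →₀ ℕ, D < m k → coeff m p = 0 := fun m hm => by
    by_contra h
    have := hp m (mem_support_iff.2 h)
    omega
  intro m hm
  by_contra hlt
  rw [not_le] at hlt
  rw [mem_support_iff, liebSokalStep_apply] at hm
  apply hm
  rw [coeff_sub, coeff_C_mul, coeff_add, coeff_X_mul', coeff_pderiv, coeff_pderiv, coeff_pderiv,
    hc m hlt, hc (m - Finsupp.single i 1 + Finsupp.single i 1) (by
      simpa [Finsupp.single_eq_of_ne hki] using hlt),
    hc (m + Finsupp.single j 1 + Finsupp.single i 1) (by simp; omega)]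
  simp

theorem degreeOf_liebSokal_le_of_ne {i j k : σ} (hki : k ≠ i) (d D : ℕ) :
    ∀ {p : MvPolynomial σ ℂ}, p.degreeOf k ≤ D → (liebSokal i j d p).degreeOf k ≤ D := by
  induction d with
  | zero => intro p hp; exact hp
  | succ d ih =>
    intro p hp
    exact ih (degreeOf_liebSokalStep_le_of_ne hki _ _ hp)

/-- The replacement of the variables `w i` by `-∂_{u i}`, for `i` in a list, on polynomials of
degree at most `d` in these variables. -/
def liebSokalList (w u : ι → σ) (d : ℕ) (l : List ι) : Module.End ℂ (MvPolynomial σ ℂ) :=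
  (l.map fun i => liebSokal (w i) (u i) d).prod

theorem IsStableOrZero.liebSokalList [Finite σ] {w u : ι → σ} (hw : Function.Injective w)
    (hwu : ∀ i j, w i ≠ u j) (d : ℕ) {l : List ι} (hl : l.Nodup) {p : MvPolynomial σ ℂ}
    (hp : IsStableOrZero p) (hd : ∀ i, p.degreeOf (w i) ≤ d) :
    IsStableOrZero (liebSokalList w u d l p) := by
  -- The degree bound must be carried along for the variables that have yet to be replaced.
  suffices h : IsStableOrZero (StabilityPreservers.liebSokalList w u d l p) ∧
      ∀ i ∉ l, (StabilityPreservers.liebSokalList w u d l p).degreeOf (w i) ≤ d from h.1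
  induction l with
  | nil => exact ⟨hp, fun i _ => hd i⟩
  | cons j l ih =>
    rw [List.nodup_cons] at hl
    have ih := ih hl.2
    refine ⟨ih.1.liebSokal (hwu j j) (ih.2 j hl.1), fun i hi => ?_⟩
    rw [List.mem_cons, not_or] at hi
    exact degreeOf_liebSokal_le_of_ne (hw.ne hi.1) _ _ (ih.2 i hi.2)

theorem liebSokalList_prod_X_pow_mul {w u : ι → σ} (hw : Function.Injective w)
    (hwu : ∀ i j, w i ≠ u j) {d : ℕ} {b : ι → ℕ} (hb : ∀ i, b i ≤ d) {l : List ι} (hl : l.Nodup) :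
    ∀ {M : MvPolynomial σ ℂ}, (∀ i ∈ l, pderiv (w i) M = 0) →
      liebSokalList w u d l ((l.map fun i => X (w i) ^ b i).prod * M) =
        (l.map fun i => (-1) ^ b i).prod * derivList u b l M := by
  induction l with
  | nil => intro M _; simp [liebSokalList, derivList]
  | cons j l ih =>
    intro M hM
    rw [List.nodup_cons] at hl
    rw [List.forall_mem_cons] at hM
    have h1 := ih hl.2 (M := X (w j) ^ b j * M) (fun i hi => by
      have hij : j ≠ i := fun h => hl.1 (h ▸ hi)
      rw [pderiv_mul, hM.2 i hi, pderiv_pow, pderiv_X_of_ne (hw.ne hij)]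
      simp)
    rw [derivList_const_mul (fun i _ => by
      rw [pderiv_pow, pderiv_X_of_ne (hwu j i)]
      simp)] at h1
    have h2 : liebSokalList w u d (j :: l) = liebSokal (w j) (u j) d * liebSokalList w u d l := by
      simp [liebSokalList]
    rw [h2, Module.End.mul_apply, List.map_cons, List.prod_cons,
      mul_assoc, mul_left_comm, h1]
    have h3 : ((l.map fun i => (-1 : MvPolynomial σ ℂ) ^ b i).prod) =
        C ((l.map fun i => (-1 : ℂ) ^ b i).prod) := by
      rw [map_list_prod, List.map_map]
      simp [Function.comp_def]
    rw [mul_left_comm, liebSokal_X_pow_mul (hwu j j) (hb j)]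
    · rw [h3, pderiv_pow_const_mul (by simp)]
      simp only [derivList, List.map_cons, List.prod_cons, Module.End.mul_apply, h3]
      ring
    · rw [pderiv_mul, h3, pderiv_C, pderiv_derivList_eq_zero hM.1]
      simp

end LiebSokalList

/-! ### Sufficiency: a stable symbol gives a stability preserver. -/

section Operators

variable {n : ℕ}

theorem opCoeff_zero : opCoeff (0 : weylAlgebra n) = 0 :=
  diffOp_injective n (by rw [diffOp_opCoeff, map_zero, ZeroMemClass.coe_zero])

/-- The extension of `diffOp n a` to complex polynomials. -/
def complexDiffOp (a : ((Fin n →₀ ℕ) × (Fin n →₀ ℕ)) →₀ ℝ) :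
    Module.End ℂ (MvPolynomial (Fin n) ℂ) :=
  a.sum fun p c => (c : ℂ) • (LinearMap.mulLeft ℂ (monomial p.1 1) *
    derivList id p.2 (List.finRange n))

/-- The value at `(z, w)` of the symbol with coefficients `a`. -/
def symbolEval (a : ((Fin n →₀ ℕ) × (Fin n →₀ ℕ)) →₀ ℝ) (z w : Fin n → ℂ) : ℂ :=
  a.sum fun p c => (c : ℂ) * ((∏ i, z i ^ p.1 i) * ∏ i, w i ^ p.2 i)

theorem eval_map_negW_symbol (T : weylAlgebra n) (x : Fin n ⊕ Fin n → ℂ) :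
    eval x (map (algebraMap ℝ ℂ) (negW (symbol T))) =
      symbolEval (opCoeff T) (fun i => x (Sum.inl i)) (fun i => -x (Sum.inr i)) := by
  simp [symbol, negW, symbolEval, Finsupp.sum, map_sum]

theorem map_partialPow (b : Fin n →₀ ℕ) (f : MvPolynomial (Fin n) ℝ) :
    map (algebraMap ℝ ℂ) (partialPow b f) =
      derivList id b (List.finRange n) (map (algebraMap ℝ ℂ) f) := by
  rw [partialPow, derivList]
  induction List.finRange n with
  | nil => rfl
  | cons j l ih =>
    simp only [List.map_cons, List.prod_cons, Module.End.mul_apply] at ih ⊢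
    rw [← ih]
    generalize ((l.map fun i => (pderiv i).toLinearMap ^ b i).prod :
      Module.End ℝ (MvPolynomial (Fin n) ℝ)) f = q
    induction b j with
    | zero => rfl
    | succ k ihk =>
      rw [pow_succ', Module.End.mul_apply, pow_succ', Module.End.mul_apply, ← ihk]
      exact pderiv_map.symm

theorem map_diffOp (a : ((Fin n →₀ ℕ) × (Fin n →₀ ℕ)) →₀ ℝ) (f : MvPolynomial (Fin n) ℝ) :
    map (algebraMap ℝ ℂ) (diffOp n a f) = complexDiffOp a (map (algebraMap ℝ ℂ) f) := by
  simp only [diffOp, Finsupp.linearCombination_apply, complexDiffOp, Finsupp.sum,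
    LinearMap.sum_apply, map_sum, LinearMap.smul_apply, monomialOp, Module.End.mul_apply,
    LinearMap.mulLeft_apply, ← map_partialPow]
  refine Finset.sum_congr rfl fun p _ => ?_
  simp [smul_eq_C_mul, map_monomial]

theorem eval_complexDiffOp (a : ((Fin n →₀ ℕ) × (Fin n →₀ ℕ)) →₀ ℝ) (f : MvPolynomial (Fin n) ℂ)
    (z : Fin n → ℂ) : eval z (complexDiffOp a f) = a.sum fun p c =>
      (c : ℂ) * ((∏ i, z i ^ p.1 i) * eval z (derivList id p.2 (List.finRange n) f)) := by
  simp only [complexDiffOp, Finsupp.sum, LinearMap.sum_apply, map_sum, LinearMap.smul_apply,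
    Module.End.mul_apply, LinearMap.mulLeft_apply, smul_eval, map_mul, eval_monomial, one_mul]
  refine Finset.sum_congr rfl fun p _ => ?_
  rw [Finsupp.prod_fintype _ _ (fun i => pow_zero _)]

/-- If `F(z, -w)` is stable, the operator with symbol `F` preserves stability. -/
theorem isStableOrZero_complexDiffOp (a : ((Fin n →₀ ℕ) × (Fin n →₀ ℕ)) →₀ ℝ)
    (ha : ∀ z w : Fin n → ℂ, (∀ i, 0 < (z i).im) → (∀ i, 0 < (w i).im) →
      symbolEval a z (fun i => -w i) ≠ 0) {f : MvPolynomial (Fin n) ℂ} (hf : IsStable f) :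
    IsStableOrZero (complexDiffOp a f) := by
  -- Three blocks of variables `(z, w, u)`, with `G = F(z, -w) f(u)`. The signs `(-1)^β` in `Q` come
  -- from `-w` and cancel those of `w ↦ -∂_u`.
  let w : Fin n → (Fin n ⊕ Fin n) ⊕ Fin n := fun i => Sum.inl (Sum.inr i)
  let u : Fin n → (Fin n ⊕ Fin n) ⊕ Fin n := Sum.inr
  let Q : (Fin n →₀ ℕ) × (Fin n →₀ ℕ) → ℝ → MvPolynomial ((Fin n ⊕ Fin n) ⊕ Fin n) ℂ := fun p c =>
    C (c * ((List.finRange n).map fun i => (-1 : ℂ) ^ p.2 i).prod) *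
      ∏ i, X (Sum.inl (Sum.inl i)) ^ p.1 i
  let G : MvPolynomial ((Fin n ⊕ Fin n) ⊕ Fin n) ℂ := a.sum fun p c =>
    ((List.finRange n).map fun i => X (w i) ^ p.2 i).prod * (Q p c * rename u f)
  have hw : Function.Injective w := fun i j h => Sum.inr_injective (Sum.inl_injective h)
  have hwu : ∀ i j, w i ≠ u j := fun i j => Sum.inl_ne_inr
  have hG : IsStable G := by
    intro x hx
    have h1 : eval x G = symbolEval a (fun i => x (Sum.inl (Sum.inl i))) (fun i => -x (w i)) *
        eval (x ∘ u) f := by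
      simp only [G, Q, symbolEval, Finsupp.sum, map_sum, Finset.sum_mul, map_mul, eval_rename]
      refine Finset.sum_congr rfl fun p _ => ?_
      simp only [← Fin.prod_univ_def, map_prod, map_pow, eval_X, eval_C]
      have : ∏ i, (-x (w i)) ^ p.2 i = (∏ i, (-1) ^ p.2 i) * ∏ i, x (w i) ^ p.2 i := by
        rw [← Finset.prod_mul_distrib]
        exact Finset.prod_congr rfl fun i _ => neg_pow _ _
      rw [this]
      ring
    rw [h1]
    exact mul_ne_zero (ha _ _ (fun i => hx _) fun i => hx _) (hf _ fun i => hx _)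
  obtain ⟨d₁, hd₁⟩ : ∃ d, ∀ i, G.degreeOf (w i) ≤ d :=
    ⟨_, fun i => Finset.le_sup (f := fun i => G.degreeOf (w i)) (Finset.mem_univ i)⟩
  obtain ⟨d₂, hd₂⟩ : ∃ d, ∀ p ∈ a.support, ∀ i, p.2 i ≤ d :=
    ⟨a.support.sup fun p => p.2.degree, fun p hp i => (Finsupp.le_degree i p.2).trans
      (Finset.le_sup (f := fun p => p.2.degree) hp)⟩
  have h2 := IsStableOrZero.liebSokalList hw hwu (max d₁ d₂) (List.nodup_finRange n) (Or.inl hG)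
    fun i => (hd₁ i).trans (le_max_left _ _)
  have hQ : ∀ p c i, pderiv (Sum.inr i) (Q p c) = 0 ∧ pderiv (w i) (Q p c) = 0 := by
    intro p c i
    have : ∀ j : (Fin n ⊕ Fin n) ⊕ Fin n, (∀ i, Sum.inl (Sum.inl i) ≠ j) →
        pderiv j (Q p c) = 0 := by
      intro j hj
      rw [pderiv_C_mul, Finset.prod_induction _ (fun q => pderiv j q = 0) _ _ _, mul_zero]
      · intro q r hq hr
        rw [pderiv_mul, hq, hr]
        simp
      · simp
      · intro i _
        rw [pderiv_pow, pderiv_X_of_ne (hj i)]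
        simp
    exact ⟨this _ fun j => Sum.inl_ne_inr, this _ fun j h => Sum.inl_ne_inr (Sum.inl_injective h)⟩
  have hren : ∀ i, pderiv (w i) (rename u f) = 0 := fun i => by
    refine pderiv_eq_zero_of_notMem_vars fun h => ?_
    obtain ⟨j, -, hj⟩ := Finset.mem_image.1 (vars_rename u f h)
    exact hwu i j hj.symm
  have h3 : ∀ x, eval x (liebSokalList w u (max d₁ d₂) (List.finRange n) G) = a.sum fun p c =>
      (c : ℂ) * ((∏ i, x (Sum.inl (Sum.inl i)) ^ p.1 i) *
        eval (x ∘ u) (derivList id p.2 (List.finRange n) f)) := by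
    intro x
    simp only [G, Finsupp.sum, map_sum]
    refine Finset.sum_congr rfl fun p hp => ?_
    rw [liebSokalList_prod_X_pow_mul hw hwu (fun i => (hd₂ p hp i).trans (le_max_right _ _))
      (List.nodup_finRange n) (fun i _ => by rw [pderiv_mul, hren, (hQ _ _ i).2]; simp),
      derivList_const_mul (fun i _ => (hQ _ _ i).1), ← rename_derivList Sum.inr_injective]
    simp only [Q, map_mul, eval_rename, ← Fin.prod_univ_def, map_prod, map_pow, eval_X, eval_C,
      map_neg, map_one]
    have : (∏ i, (-1 : ℂ) ^ p.2 i) * ∏ i, (-1 : ℂ) ^ p.2 i = 1 := by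
      rw [← Finset.prod_mul_distrib]
      refine Finset.prod_eq_one fun i _ => ?_
      rw [← mul_pow]
      simp
    linear_combination ((a p : ℂ) * (∏ i, x (Sum.inl (Sum.inl i)) ^ p.1 i) *
      eval (x ∘ u) (derivList id p.2 (List.finRange n) f)) * this
  -- The result no longer involves the `w` block, so any `w'` will do; restricting to `u = z` keeps
  -- the point in the upper half-plane.
  have h4 : ∀ z w', eval (Sum.elim (Sum.elim z w') z)
      (liebSokalList w u (max d₁ d₂) (List.finRange n) G) = eval z (complexDiffOp a f) := by
    intro z w'
    rw [h3, eval_complexDiffOp]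
    rfl
  rcases h2 with h2 | h2
  · refine Or.inl fun z hz => ?_
    rw [← h4 z z]
    refine h2 _ fun i => ?_
    rcases i with (i | i) | i <;> exact hz i
  · refine Or.inr (MvPolynomial.funext fun z => ?_)
    rw [← h4 z z, h2, map_zero, map_zero]

theorem isRealStable_or_eq_zero_iff {σ : Type*} {f : MvPolynomial σ ℝ} :
    (IsRealStable f ∨ f = 0) ↔ IsStableOrZero (map (algebraMap ℝ ℂ) f) := by
  rw [IsStableOrZero, IsRealStable, map_eq_zero_iff _
    (map_injective _ (algebraMap ℝ ℂ).injective)]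

theorem mem_realStabilityPreservers_of_isRealStable {T : weylAlgebra n}
    (hT : IsRealStable (negW (symbol T))) : T ∈ realStabilityPreservers n := by
  have h1 : ∀ z w : Fin n → ℂ, (∀ i, 0 < (z i).im) → (∀ i, 0 < (w i).im) →
      symbolEval (opCoeff T) z (fun i => -w i) ≠ 0 := by
    intro z w hz hw
    have := hT (Sum.elim z w) (by rintro (i | i); exacts [hz i, hw i])
    rwa [eval_map_negW_symbol] at this
  refine ⟨?_, fun f hf => ?_⟩
  · rintro rfl
    refine h1 (fun _ => Complex.I) (fun _ => Complex.I) (by simp) (by simp) ?_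
    rw [opCoeff_zero, symbolEval, Finsupp.sum_zero_index]
  · rw [isRealStable_or_eq_zero_iff, ← diffOp_opCoeff, map_diffOp]
    exact isStableOrZero_complexDiffOp _ h1 hf

end Operators

/-! ### Pencils of two polynomials. -/

section Pencil

variable {σ : Type*}

theorem exists_norm_one_mul_add_eq_zero {α β : ℂ} (h : ‖α‖ = ‖β‖) :
    ∃ c : ℂ, ‖c‖ = 1 ∧ c * β + (starRingEnd ℂ) c * α = 0 := by
  rcases eq_or_ne β 0 with rfl | hβ
  · exact ⟨1, by simp, by simpa using h⟩
  · obtain ⟨c, hc⟩ := IsAlgClosed.exists_pow_nat_eq (-(α / β)) (n := 2) (by norm_num)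
    have hn : ‖c‖ = 1 := by
      have : ‖c‖ ^ 2 = 1 := by
        rw [← norm_pow, hc, norm_neg, norm_div, h, div_self (norm_ne_zero_iff.2 hβ)]
      exact (pow_eq_one_iff_of_nonneg (norm_nonneg c) two_ne_zero).1 this
    refine ⟨c, hn, ?_⟩
    have hc0 : c ≠ 0 := norm_ne_zero_iff.1 (by rw [hn]; exact one_ne_zero)
    have h1 : c * (starRingEnd ℂ) c = 1 := by
      rw [Complex.mul_conj, Complex.normSq_eq_norm_sq, hn]
      simp
    have h2 : α = -(c ^ 2 * β) := by
      rw [hc]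
      field_simp
    rw [h2]
    linear_combination -c * β * h1

/-- If all real members of a pencil are stable or zero, the moduli of the generators do not
cross in the upper half-plane. -/
theorem isStable_of_pencil {A B : MvPolynomial σ ℂ}
    (h : ∀ c : ℂ, ‖c‖ = 1 → IsStableOrZero (C c * B + C ((starRingEnd ℂ) c) * A)) {z₁ : σ → ℂ}
    (hz₁ : ∀ i, 0 < (z₁ i).im) (hlt : ‖eval z₁ A‖ < ‖eval z₁ B‖) : IsStable B := by
  intro z hz h0
  let γ : ℝ → σ → ℂ := fun s i => z₁ i + (z i - z₁ i) * s
  let φ : ℝ → ℝ := fun s => ‖eval (γ s) B‖ - ‖eval (γ s) A‖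
  -- On the segment from `z₁` to a supposed zero `z` of `B`, the moduli of `A` and `B` agree
  -- somewhere. There a suitable member of the pencil vanishes, so it is identically zero; but this
  -- contradicts `hlt` at `z₁`.
  have hγ : Continuous γ := by fun_prop
  have hcont : ∀ p : MvPolynomial σ ℂ, Continuous fun s => eval (γ s) p :=
    fun p => (MvPolynomial.continuous_eval p).comp hγ
  have hφ : ContinuousOn φ (Set.Icc 0 1) := ((hcont B).norm.sub (hcont A).norm).continuousOn
  have hγ0 : γ 0 = z₁ := by funext i; simp [γ]
  have hγ1 : γ 1 = z := by funext i; simp [γ]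
  obtain ⟨s, hs, hs0⟩ := intermediate_value_Icc' zero_le_one hφ
    (show (0 : ℝ) ∈ Set.Icc (φ 1) (φ 0) by
      constructor
      · simp [φ, hγ1, h0]
      · simp only [φ, hγ0]
        linarith)
  have hs1 : ‖eval (γ s) A‖ = ‖eval (γ s) B‖ := by
    simp only [φ] at hs0
    linarith
  have hpos : ∀ i, 0 < (γ s i).im := by
    intro i
    have : (γ s i).im = (1 - s) * (z₁ i).im + s * (z i).im := by
      simp [γ]
      ring
    rw [this]
    rcases hs.1.eq_or_lt with h | h
    · rw [← h]
      simpa using hz₁ i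
    · exact add_pos_of_nonneg_of_pos (mul_nonneg (by linarith [hs.2]) (hz₁ i).le)
        (mul_pos h (hz i))
  obtain ⟨c, hc, hc0⟩ := exists_norm_one_mul_add_eq_zero hs1
  rcases h c hc with hst | hzero
  · exact hst _ hpos (by simpa using hc0)
  · have h1 := congrArg (eval z₁) hzero
    simp only [map_add, map_mul, eval_C, map_zero] at h1
    have h2 := congrArg norm (eq_neg_of_add_eq_zero_left h1)
    rw [norm_neg, norm_mul, norm_mul, RCLike.norm_conj, hc, one_mul, one_mul] at h2
    linarith

end Pencil

/-! ### Polynomial approximations of exponentials as test functions. -/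

section TestPolynomials

variable {n : ℕ}

/-- The polynomials `∏ (1 - wᵢ zᵢ / k) ^ k`, which approximate `exp (-w · z)`. -/
def expApprox (k : ℕ) (w : Fin n → ℂ) : MvPolynomial (Fin n) ℂ :=
  ((List.finRange n).map fun i => (1 - C (w i / k) * X i) ^ k).prod

theorem eval_expApprox (k : ℕ) (w z : Fin n → ℂ) :
    eval z (expApprox k w) = ∏ i, (1 - w i / k * z i) ^ k := by
  simp [expApprox, ← Fin.prod_univ_def]

theorem pderiv_pow_linear_pow {σ : Type*} (i : σ) (v : ℂ) (k b : ℕ) :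
    ((pderiv i).toLinearMap ^ b : Module.End ℂ (MvPolynomial σ ℂ)) ((1 - C v * X i) ^ k) =
      C ((k.descFactorial b : ℂ) * (-v) ^ b) * (1 - C v * X i) ^ (k - b) := by
  induction b with
  | zero => simp
  | succ b ih =>
    rw [pow_succ', Module.End.mul_apply, ih, Derivation.coeFn_coe, pderiv_C_mul, pderiv_pow]
    have : pderiv i (1 - C v * X i : MvPolynomial σ ℂ) = C (-v) := by
      simp
    rw [this, Nat.descFactorial_succ, ← Nat.sub_sub]
    simp only [C_mul, C_neg, C_pow, Nat.cast_mul, map_natCast]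
    ring

theorem derivList_expApprox (b : Fin n → ℕ) (k : ℕ) (v : Fin n → ℂ) {l : List (Fin n)}
    (hl : l.Nodup) :
    derivList id b l ((l.map fun i => (1 - C (v i) * X i) ^ k).prod) =
      (l.map fun i => C ((k.descFactorial (b i) : ℂ) * (-v i) ^ b i) *
        (1 - C (v i) * X i) ^ (k - b i)).prod := by
  induction l with
  | nil => rfl
  | cons j l ih =>
    rw [List.nodup_cons] at hl
    have hne : ∀ i ∈ l, i ≠ j := fun i hi h => hl.1 (h ▸ hi)
    rw [List.map_cons, List.prod_cons]
    have h1 : ∀ M, derivList id b (j :: l) M =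
        ((pderiv j).toLinearMap ^ b j : Module.End ℂ (MvPolynomial (Fin n) ℂ))
          (derivList id b l M) := fun M => by
      simp [derivList]
    rw [h1, derivList_const_mul (fun i hi => by
      rw [pderiv_pow]
      simp [pderiv_X_of_ne (hne i hi).symm]), ih hl.2, mul_comm, pderiv_pow_const_mul,
      pderiv_pow_linear_pow, List.map_cons, List.prod_cons, mul_comm]
    have : ∀ l' : List (Fin n), (∀ i ∈ l', i ≠ j) →
        pderiv j (l'.map fun i => C ((k.descFactorial (b i) : ℂ) * (-v i) ^ b i) *
          (1 - C (v i) * X i) ^ (k - b i)).prod = 0 := by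
      intro l' hl'
      induction l' with
      | nil => simp
      | cons i l' ih' =>
        rw [List.forall_mem_cons] at hl'
        rw [List.map_cons, List.prod_cons, pderiv_mul, ih' hl'.2, pderiv_C_mul, pderiv_pow]
        simp [pderiv_X_of_ne hl'.1]
    exact this l hne

theorem eval_complexDiffOp_expApprox (a : ((Fin n →₀ ℕ) × (Fin n →₀ ℕ)) →₀ ℝ) (k : ℕ)
    (w z : Fin n → ℂ) :
    eval z (complexDiffOp a (expApprox k w)) = a.sum fun p c =>
      (c : ℂ) * ((∏ i, z i ^ p.1 i) * ∏ i, ((k.descFactorial (p.2 i) : ℂ) *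
        (-(w i / k)) ^ p.2 i * (1 - w i / k * z i) ^ (k - p.2 i))) := by
  rw [eval_complexDiffOp]
  refine Finset.sum_congr rfl fun p _ => ?_
  dsimp only
  rw [expApprox, derivList_expApprox _ _ _ (List.nodup_finRange n), ← Fin.prod_univ_def]
  simp

theorem tendsto_descFactorial_mul_pow (w : ℂ) (b : ℕ) :
    Filter.Tendsto (fun k : ℕ => (k.descFactorial b : ℂ) * (-(w / k)) ^ b) Filter.atTop
      (nhds ((-w) ^ b)) := by
  induction b with
  | zero => simp
  | succ b ih =>
    have h1 : Filter.Tendsto (fun k : ℕ => ((k - b : ℕ) : ℂ) * (-(w / k))) Filter.atTop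
        (nhds (-w)) := by
      have h2 : Filter.Tendsto (fun k : ℕ => -w + b * w * (1 / (k : ℂ))) Filter.atTop
          (nhds (-w + b * w * 0)) :=
        (tendsto_one_div_atTop_nhds_zero_nat.const_mul _).const_add _
      rw [mul_zero, add_zero] at h2
      refine h2.congr' ?_
      filter_upwards [Filter.eventually_ge_atTop (b + 1)] with k hk
      have hk0 : (k : ℂ) ≠ 0 := by
        have : k ≠ 0 := by omega
        exact_mod_cast this
      rw [Nat.cast_sub (by omega)]
      field_simp
      ring
    rw [pow_succ']
    refine (h1.mul ih).congr fun k => ?_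
    rw [Nat.descFactorial_succ]
    push_cast
    ring

theorem tendsto_one_sub_div_mul_pow_sub (w z : ℂ) (b : ℕ) :
    Filter.Tendsto (fun k : ℕ => (1 - w / k * z) ^ (k - b)) Filter.atTop
      (nhds (Complex.exp (-(w * z)))) := by
  have h1 := Complex.tendsto_one_add_div_pow_exp (-(w * z))
  have h2 : Filter.Tendsto (fun k : ℕ => 1 - w / k * z) Filter.atTop (nhds 1) := by
    have : Filter.Tendsto (fun k : ℕ => 1 - w * z * (1 / (k : ℂ))) Filter.atTop
        (nhds (1 - w * z * 0)) :=
      (tendsto_one_div_atTop_nhds_zero_nat.const_mul _).const_sub _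
    rw [mul_zero, sub_zero] at this
    refine this.congr fun k => ?_
    ring
  have h3 : Filter.Tendsto (fun k : ℕ => ((1 - w / k * z) ^ b)⁻¹) Filter.atTop (nhds 1) := by
    have := (h2.pow b).inv₀ (by simp)
    simpa using this
  have h4 := h1.mul h3
  rw [mul_one] at h4
  refine h4.congr' ?_
  filter_upwards [Filter.eventually_ge_atTop b, h2.eventually_ne one_ne_zero] with k hk hne
  rw [pow_sub₀ _ hne hk]
  congr 2
  ring

theorem tendsto_eval_complexDiffOp_expApprox (a : ((Fin n →₀ ℕ) × (Fin n →₀ ℕ)) →₀ ℝ)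
    (w z : Fin n → ℂ) :
    Filter.Tendsto (fun k => eval z (complexDiffOp a (expApprox k w))) Filter.atTop
      (nhds (symbolEval a z (fun i => -w i) * ∏ i, Complex.exp (-(w i * z i)))) := by
  simp only [eval_complexDiffOp_expApprox, symbolEval, Finsupp.sum, Finset.sum_mul, mul_assoc,
    ← Finset.prod_mul_distrib]
  refine tendsto_finsetSum _ fun p _ => ?_
  refine Filter.Tendsto.const_mul _ ?_
  refine tendsto_finsetProd _ fun i _ => ?_
  refine Filter.Tendsto.const_mul _ ?_
  simpa only [mul_assoc] using
    (tendsto_descFactorial_mul_pow (w i) (p.2 i)).mul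
      (tendsto_one_sub_div_mul_pow_sub (w i) (z i) _)

/-- The bounded degree factor of the image of `expApprox k w` under a differential operator. -/
def expApproxCofactor (a : ((Fin n →₀ ℕ) × (Fin n →₀ ℕ)) →₀ ℝ) (D k : ℕ) (w : Fin n → ℂ) :
    MvPolynomial (Fin n) ℂ :=
  a.sum fun p c => C (c : ℂ) * ((∏ i, X i ^ p.1 i) * ∏ i,
    (C ((k.descFactorial (p.2 i) : ℂ) * (-(w i / k)) ^ p.2 i) *
      (1 - C (w i / k) * X i) ^ (D - p.2 i)))

/-- The degree of the image grows with `k`, whereas Hurwitz' theorem here needs bounded degree. The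
common linear factors carry the growth and are split off. -/
theorem complexDiffOp_expApprox {a : ((Fin n →₀ ℕ) × (Fin n →₀ ℕ)) →₀ ℝ} {D k : ℕ}
    (hD : ∀ p ∈ a.support, ∀ i, p.2 i ≤ D) (hk : D ≤ k) (w : Fin n → ℂ) :
    complexDiffOp a (expApprox k w) =
      (∏ i, (1 - C (w i / k) * X i) ^ (k - D)) * expApproxCofactor a D k w := by
  refine MvPolynomial.funext fun z => ?_
  rw [eval_complexDiffOp_expApprox]
  simp only [expApproxCofactor, Finsupp.sum, map_mul, map_sum, map_prod, map_pow, eval_C, eval_X,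
    map_sub, map_one, Finset.mul_sum]
  refine Finset.sum_congr rfl fun p hp => ?_
  have h : ∏ i, ((k.descFactorial (p.2 i) : ℂ) * (-(w i / k)) ^ p.2 i *
      (1 - w i / k * z i) ^ (k - p.2 i)) = (∏ i, (1 - w i / k * z i) ^ (k - D)) *
        ∏ i, ((k.descFactorial (p.2 i) : ℂ) * (-(w i / k)) ^ p.2 i *
          (1 - w i / k * z i) ^ (D - p.2 i)) := by
    rw [← Finset.prod_mul_distrib]
    refine Finset.prod_congr rfl fun i _ => ?_
    have : k - p.2 i = (k - D) + (D - p.2 i) := by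
      have := hD p hp i
      omega
    rw [this, pow_add]
    ring
  rw [h]
  ring

theorem exists_totalDegree_expApproxCofactor_le (a : ((Fin n →₀ ℕ) × (Fin n →₀ ℕ)) →₀ ℝ) (D : ℕ)
    (w : Fin n → ℂ) : ∃ N, ∀ k, (expApproxCofactor a D k w).totalDegree ≤ N := by
  refine ⟨(a.support.sup fun p => ∑ i, p.1 i) + n * D, fun k => ?_⟩
  refine totalDegree_finsetSum_le fun p hp => ?_
  refine (totalDegree_mul _ _).trans ?_
  rw [totalDegree_C, zero_add]
  refine (totalDegree_mul _ _).trans (add_le_add ?_ ?_)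
  · refine (totalDegree_finsetProd _ _).trans
      (le_trans ?_ (Finset.le_sup (f := fun p : (Fin n →₀ ℕ) × (Fin n →₀ ℕ) => ∑ i, p.1 i) hp))
    refine Finset.sum_le_sum fun i _ => ?_
    simp
  · refine (totalDegree_finsetProd _ _).trans ?_
    have : ∀ i ∈ Finset.univ, (C ((k.descFactorial (p.2 i) : ℂ) * (-(w i / k)) ^ p.2 i) *
        (1 - C (w i / k) * X i : MvPolynomial (Fin n) ℂ) ^ (D - p.2 i)).totalDegree ≤ D := by
      intro i _
      refine (totalDegree_mul _ _).trans ?_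
      rw [totalDegree_C, zero_add]
      refine (totalDegree_pow _ _).trans ?_
      have h1 : (1 - C (w i / k) * X i : MvPolynomial (Fin n) ℂ).totalDegree ≤ 1 := by
        refine (totalDegree_sub _ _).trans (max_le (by simp) ((totalDegree_mul _ _).trans ?_))
        rw [totalDegree_C, totalDegree_X]
      calc _ ≤ (D - p.2 i) * 1 := Nat.mul_le_mul_left _ h1
        _ ≤ D := by omega
    refine (Finset.sum_le_card_nsmul _ _ _ this).trans ?_
    simp

theorem tendsto_eval_expApproxCofactor (a : ((Fin n →₀ ℕ) × (Fin n →₀ ℕ)) →₀ ℝ) (D : ℕ)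
    (w z : Fin n → ℂ) :
    Filter.Tendsto (fun k => eval z (expApproxCofactor a D k w)) Filter.atTop
      (nhds (symbolEval a z (fun i => -w i))) := by
  simp only [expApproxCofactor, symbolEval, Finsupp.sum, map_mul, map_sum, map_prod, map_pow,
    eval_C, eval_X, map_sub, map_one]
  refine tendsto_finsetSum _ fun p _ => ?_
  refine Filter.Tendsto.const_mul _ (Filter.Tendsto.const_mul _ ?_)
  refine tendsto_finsetProd _ fun i _ => ?_
  have h2 : Filter.Tendsto (fun k : ℕ => 1 - w i / k * z i) Filter.atTop (nhds 1) := by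
    have : Filter.Tendsto (fun k : ℕ => 1 - w i * z i * (1 / (k : ℂ))) Filter.atTop
        (nhds (1 - w i * z i * 0)) :=
      (tendsto_one_div_atTop_nhds_zero_nat.const_mul _).const_sub _
    rw [mul_zero, sub_zero] at this
    refine this.congr fun k => ?_
    ring
  simpa using (tendsto_descFactorial_mul_pow (w i) (p.2 i)).mul (h2.pow (D - p.2 i))

theorem norm_one_sub_conj_lt {k : ℕ} (hk : k ≠ 0) {w z : ℂ} (hw : 0 < w.im) (hz : 0 < z.im) :
    ‖1 - (starRingEnd ℂ) w / k * z‖ < ‖1 - w / k * z‖ := by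
  have hk' : (0 : ℝ) < k := by exact_mod_cast Nat.pos_of_ne_zero hk
  refine lt_of_pow_lt_pow_left₀ 2 (norm_nonneg _) ?_
  have h : ‖1 - w / k * z‖ ^ 2 - ‖1 - (starRingEnd ℂ) w / k * z‖ ^ 2 = 4 / k * (w.im * z.im) := by
    rw [Complex.sq_norm, Complex.sq_norm, Complex.normSq_apply, Complex.normSq_apply]
    simp [Complex.div_natCast_re, Complex.div_natCast_im]
    ring
  have : 0 < 4 / k * (w.im * z.im) := by positivity
  linarith

theorem norm_eval_expApprox_conj_lt [NeZero n] {k : ℕ} (hk : k ≠ 0) {w z : Fin n → ℂ}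
    (hw : ∀ i, 0 < (w i).im) (hz : ∀ i, 0 < (z i).im) :
    ‖eval z (expApprox k fun i => (starRingEnd ℂ) (w i))‖ < ‖eval z (expApprox k w)‖ := by
  simp only [eval_expApprox, norm_prod, norm_pow]
  have hlt := fun i => norm_one_sub_conj_lt hk (hw i) (hz i)
  -- Strict comparison of products requires positive factors on the smaller side; if one vanishes,
  -- that side is zero.
  by_cases h : ∀ i, 0 < ‖1 - (starRingEnd ℂ) (w i) / k * z i‖
  · exact Finset.prod_lt_prod_of_nonempty (fun i _ => pow_pos (h i) k)
      (fun i _ => pow_lt_pow_left₀ (hlt i) (norm_nonneg _) hk) Finset.univ_nonempty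
  · push Not at h
    obtain ⟨i, hi⟩ := h
    rw [Finset.prod_eq_zero (Finset.mem_univ i)]
    · exact Finset.prod_pos fun i _ => pow_pos ((norm_nonneg _).trans_lt (hlt i)) k
    · rw [le_antisymm hi (norm_nonneg _), zero_pow hk]

theorem exists_map_eq_of_map_conj_eq {σ : Type*} {p : MvPolynomial σ ℂ}
    (hp : map (starRingEnd ℂ) p = p) : ∃ f : MvPolynomial σ ℝ, map (algebraMap ℝ ℂ) f = p := by
  refine mem_range_map_iff_coeffs_subset.2 fun c hc => ?_
  obtain ⟨m, -, rfl⟩ := mem_coeffs_iff.1 hc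
  have : (starRingEnd ℂ) (coeff m p) = coeff m p := by rw [← coeff_map, hp]
  exact ⟨(coeff m p).re, Complex.conj_eq_iff_re.1 this⟩

theorem map_conj_expApprox (k : ℕ) (w : Fin n → ℂ) :
    map (starRingEnd ℂ) (expApprox k w) = expApprox k fun i => (starRingEnd ℂ) (w i) := by
  simp only [expApprox, map_list_prod, List.map_map, Function.comp_def, map_pow, map_sub, map_one,
    map_mul, map_C, map_X, map_div₀, map_natCast]

/-- The sum is invariant under conjugation of its coefficients, hence real. It has no zero in the
upper half-plane because its two terms have different moduli there. -/
theorem exists_isRealStable_expApprox [NeZero n] {k : ℕ} (hk : k ≠ 0) {w : Fin n → ℂ}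
    (hw : ∀ i, 0 < (w i).im) {c : ℂ} (hc : ‖c‖ = 1) :
    ∃ f : MvPolynomial (Fin n) ℝ, IsRealStable f ∧ map (algebraMap ℝ ℂ) f =
      C c * expApprox k w +
        C ((starRingEnd ℂ) c) * expApprox k fun i => (starRingEnd ℂ) (w i) := by
  obtain ⟨f, hf⟩ := exists_map_eq_of_map_conj_eq (p := C c * expApprox k w +
    C ((starRingEnd ℂ) c) * expApprox k fun i => (starRingEnd ℂ) (w i)) (by
      simp only [map_add, map_mul, map_C, map_conj_expApprox, Complex.conj_conj]
      rw [add_comm])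
  refine ⟨f, fun z hz h0 => ?_, hf⟩
  rw [hf] at h0
  simp only [map_add, map_mul, eval_C] at h0
  have h1 := congrArg norm (eq_neg_of_add_eq_zero_left h0)
  rw [norm_neg, norm_mul, norm_mul, RCLike.norm_conj, hc, one_mul, one_mul] at h1
  exact (norm_eval_expApprox_conj_lt hk hw hz).ne' h1

end TestPolynomials

/-! ### For fixed `w`, the polynomial `F(z, -w)` in `z` is stable or zero. -/

section Dichotomy

variable {n : ℕ}

/-- The symbol with coefficients `a`, as a complex polynomial. -/
def symbolPoly (a : ((Fin n →₀ ℕ) × (Fin n →₀ ℕ)) →₀ ℝ) : MvPolynomial (Fin n ⊕ Fin n) ℂ :=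
  a.sum fun p c => monomial (Finsupp.sumFinsuppAddEquivProdFinsupp.symm p) (c : ℂ)

theorem eval_symbolPoly (a : ((Fin n →₀ ℕ) × (Fin n →₀ ℕ)) →₀ ℝ) (x : Fin n ⊕ Fin n → ℂ) :
    eval x (symbolPoly a) =
      symbolEval a (fun i => x (Sum.inl i)) (fun i => x (Sum.inr i)) := by
  simp only [symbolPoly, symbolEval, Finsupp.sum, map_sum, eval_monomial]
  refine Finset.sum_congr rfl fun p _ => ?_
  rw [Finsupp.prod_fintype _ _ (fun i => pow_zero _), Fintype.prod_sum_type]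
  rfl

theorem eval_aeval_symbolPoly (a : ((Fin n →₀ ℕ) × (Fin n →₀ ℕ)) →₀ ℝ) (z w : Fin n → ℂ) :
    eval z (aeval (Sum.elim X fun i => C (w i)) (symbolPoly a)) = symbolEval a z w := by
  have h : (eval z).comp (aeval (Sum.elim X fun i => C (w i)) :
      MvPolynomial (Fin n ⊕ Fin n) ℂ →ₐ[ℂ] MvPolynomial (Fin n) ℂ).toRingHom =
        eval (Sum.elim z w) := by
    apply MvPolynomial.ringHom_ext
    · intro r
      simp
    · rintro (i | i) <;> simp
  have := congrArg (fun g => g (symbolPoly a)) h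
  simpa [eval_symbolPoly] using this

theorem infinite_range_pos_mul_I : {t : ℂ | ∃ y : ℝ, 0 < y ∧ t = y * Complex.I}.Infinite := by
  have h := (Set.Ioi_infinite (0 : ℝ)).image (f := fun y : ℝ => (y : ℂ) * Complex.I)
    (fun x _ y _ h => by simpa using h)
  refine h.mono ?_
  rintro _ ⟨y, hy, rfl⟩
  exact ⟨y, hy, rfl⟩

theorem exists_pos_eval_mul_I_ne_zero {σ : Type*} {p : MvPolynomial σ ℂ} (hp : p ≠ 0) :
    ∃ y : σ → ℝ, (∀ i, 0 < y i) ∧ eval (fun i => y i * Complex.I) p ≠ 0 := by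
  by_contra hc
  push Not at hc
  apply hp
  refine funext_set _ (fun _ : σ => infinite_range_pos_mul_I) fun x hx => ?_
  choose y hy using fun i => hx i (Set.mem_univ i)
  rw [map_zero, show x = fun i => y i * Complex.I from _root_.funext fun i => (hy i).2]
  exact hc y fun i => (hy i).1

theorem tendsto_norm_eval_mul_exp (q : Polynomial ℂ) {κ : ℝ} (hκ : 0 < κ) :
    Filter.Tendsto (fun s : ℝ => ‖q.eval (s : ℂ)‖ * Real.exp (-κ * s)) Filter.atTop (nhds 0) := by
  have h : Filter.Tendsto (fun s : ℝ => ∑ i ∈ Finset.range (q.natDegree + 1),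
      ‖q.coeff i‖ * (s ^ (i : ℝ) * Real.exp (-κ * s))) Filter.atTop (nhds 0) := by
    have := tendsto_finsetSum (Finset.range (q.natDegree + 1)) fun i _ =>
      (tendsto_rpow_mul_exp_neg_mul_atTop_nhds_zero (i : ℝ) κ hκ).const_mul ‖q.coeff i‖
    simpa using this
  refine squeeze_zero' (Filter.Eventually.of_forall fun s => by positivity) ?_ h
  filter_upwards [Filter.eventually_ge_atTop 0] with s hs
  rw [Polynomial.eval_eq_sum_range]
  refine (mul_le_mul_of_nonneg_right (norm_sum_le _ _) (Real.exp_pos _).le).trans ?_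
  rw [Finset.sum_mul]
  refine (Finset.sum_le_sum fun i _ => ?_)
  rw [norm_mul, norm_pow, Complex.norm_real, Real.norm_of_nonneg hs, Real.rpow_natCast, mul_assoc]

theorem exists_pos_norm_eval_mul_exp_lt {p : Polynomial ℂ} (hp : p ≠ 0) (q : Polynomial ℂ) {κ : ℝ}
    (hκ : 0 < κ) : ∃ s : ℝ, 0 < s ∧ ‖q.eval (s : ℂ)‖ * Real.exp (-κ * s) < ‖p.eval (s : ℂ)‖ := by
  by_contra hc
  push Not at hc
  have h1 : Filter.Tendsto (fun s : ℝ => ‖p.eval (s : ℂ)‖) Filter.atTop (nhds 0) := by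
    refine squeeze_zero' (Filter.Eventually.of_forall fun s => norm_nonneg _) ?_
      (tendsto_norm_eval_mul_exp q hκ)
    filter_upwards [Filter.eventually_gt_atTop 0] with s hs using hc s hs
  rcases lt_or_ge 0 p.degree with hd | hd
  · have h2 := p.tendsto_norm_atTop hd (l := Filter.atTop) (z := fun s : ℝ => (s : ℂ)) (by
      simpa [Complex.norm_real] using Filter.tendsto_abs_atTop_atTop (G := ℝ))
    exact not_tendsto_nhds_of_tendsto_atTop h2 0 h1
  · obtain ⟨c, rfl⟩ : ∃ c, p = Polynomial.C c := ⟨_, Polynomial.eq_C_of_degree_le_zero hd⟩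
    simp only [Polynomial.eval_C] at h1
    have := tendsto_nhds_unique h1 tendsto_const_nhds
    rw [eq_comm, norm_eq_zero] at this
    exact hp (by rw [this, Polynomial.C_0])

theorem norm_prod_exp (y s : Fin n → ℝ) (w : Fin n → ℂ) :
    ‖∏ i, Complex.exp (-(w i * (y i * Complex.I * s i)))‖ =
      Real.exp (∑ i, (w i).im * y i * s i) := by
  rw [norm_prod, Real.exp_sum]
  refine Finset.prod_congr rfl fun i _ => ?_
  rw [Complex.norm_exp]
  congr 1
  simp
  ring

/-- Along `z = i s y` with `y > 0`, the factor `exp(-w·z)` grows exponentially in `s` and its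
counterpart for `w̄` decays. The polynomial factors cannot compensate, provided the one for `w` is
not zero on this ray. -/
theorem exists_norm_symbolEval_mul_exp_lt [NeZero n] (a : ((Fin n →₀ ℕ) × (Fin n →₀ ℕ)) →₀ ℝ)
    {w : Fin n → ℂ} (hw : ∀ i, 0 < (w i).im)
    (h : aeval (Sum.elim X fun i => C (-w i)) (symbolPoly a) ≠ (0 : MvPolynomial (Fin n) ℂ)) :
    ∃ z : Fin n → ℂ, (∀ i, 0 < (z i).im) ∧
      ‖symbolEval a z (fun i => -(starRingEnd ℂ) (w i)) *
        ∏ i, Complex.exp (-((starRingEnd ℂ) (w i) * z i))‖ <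
      ‖symbolEval a z (fun i => -w i) * ∏ i, Complex.exp (-(w i * z i))‖ := by
  obtain ⟨y, hy, hy0⟩ := exists_pos_eval_mul_I_ne_zero h
  let P : (Fin n → ℂ) → Polynomial ℂ := fun v => lineSlice 0 (fun i => y i * Complex.I)
    (aeval (Sum.elim X fun i => C (v i)) (symbolPoly a))
  have hP : ∀ v (s : ℝ), (P v).eval (s : ℂ) = symbolEval a (fun i => y i * Complex.I * s) v := by
    intro v s
    rw [eval_lineSlice, eval_aeval_symbolPoly]
    simp
  have hp : P (fun i => -w i) ≠ 0 := by
    intro h0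
    rw [eval_aeval_symbolPoly] at hy0
    have := hP (fun i => -w i) 1
    rw [h0] at this
    simp only [Polynomial.eval_zero, Complex.ofReal_one, mul_one] at this
    exact hy0 this.symm
  have hκ : 0 < ∑ i, 2 * ((w i).im * y i) :=
    Finset.sum_pos (fun i _ => mul_pos two_pos (mul_pos (hw i) (hy i))) Finset.univ_nonempty
  obtain ⟨s, hs, hlt⟩ := exists_pos_norm_eval_mul_exp_lt hp
    (P fun i => -(starRingEnd ℂ) (w i)) hκ
  refine ⟨fun i => y i * Complex.I * s, fun i => ?_, ?_⟩
  · simpa using mul_pos (hy i) hs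
  · rw [hP, hP] at hlt
    rw [norm_mul, norm_mul, norm_prod_exp y (fun _ => s), norm_prod_exp y (fun _ => s)]
    have h1 : ∑ i, ((starRingEnd ℂ) (w i)).im * y i * s =
        -(∑ i, 2 * ((w i).im * y i)) * s + ∑ i, (w i).im * y i * s := by
      rw [← Finset.sum_neg_distrib, Finset.sum_mul, ← Finset.sum_add_distrib]
      refine Finset.sum_congr rfl fun i _ => ?_
      rw [Complex.conj_im]
      ring
    rw [h1, Real.exp_add, ← mul_assoc]
    exact mul_lt_mul_of_pos_right hlt (Real.exp_pos _)

theorem isStableOrZero_of_isEmpty {σ : Type*} [IsEmpty σ] (p : MvPolynomial σ ℂ) :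
    IsStableOrZero p := by
  by_cases h : p = 0
  · exact Or.inr h
  · refine Or.inl fun z _ hz => h (MvPolynomial.funext fun y => ?_)
    rw [Subsingleton.elim y z, hz, map_zero]

/-- For a real stability preserver with symbol `F` and `w` in the upper half-plane, the polynomial
`F(z, -w)` in `z` is stable or zero. -/
theorem isStableOrZero_aeval_symbolPoly {a : ((Fin n →₀ ℕ) × (Fin n →₀ ℕ)) →₀ ℝ}
    (ha : ∀ f : MvPolynomial (Fin n) ℝ, IsRealStable f →
      IsRealStable (diffOp n a f) ∨ diffOp n a f = 0)
    {w : Fin n → ℂ} (hw : ∀ i, 0 < (w i).im) :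
    IsStableOrZero (aeval (Sum.elim X fun i => C (-w i)) (symbolPoly a) :
      MvPolynomial (Fin n) ℂ) := by
  rcases Nat.eq_zero_or_pos n with rfl | hn
  · exact isStableOrZero_of_isEmpty _
  have : NeZero n := ⟨hn.ne'⟩
  by_cases h0 : aeval (Sum.elim X fun i => C (-w i)) (symbolPoly a) = (0 : MvPolynomial (Fin n) ℂ)
  · exact Or.inr h0
  obtain ⟨z₁, hz₁, hlt⟩ := exists_norm_symbolEval_mul_exp_lt a hw h0
  obtain ⟨D, hD⟩ : ∃ d, ∀ p ∈ a.support, ∀ i, p.2 i ≤ d :=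
    ⟨a.support.sup fun p => p.2.degree, fun p hp i => (Finsupp.le_degree i p.2).trans
      (Finset.le_sup (f := fun p => p.2.degree) hp)⟩
  obtain ⟨N, hN⟩ := exists_totalDegree_expApproxCofactor_le a D w
  refine IsStableOrZero.of_tendsto (p := fun k => expApproxCofactor a D k w) (D := N) ?_
    fun z => by
      rw [eval_aeval_symbolPoly]
      exact tendsto_eval_expApproxCofactor a D w z
  -- The strict inequality between the limits at `z₁` persists for large `k`. The bound `D + 1` also
  -- ensures `k ≠ 0`.
  filter_upwards [Filter.eventually_ge_atTop (D + 1),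
    (tendsto_eval_complexDiffOp_expApprox a _ z₁).norm.eventually_lt
      (tendsto_eval_complexDiffOp_expApprox a w z₁).norm hlt] with k hk hklt
  refine ⟨?_, hN k⟩
  have hst : IsStable (complexDiffOp a (expApprox k w)) := by
    refine isStable_of_pencil (fun c hc => ?_) hz₁ hklt
    obtain ⟨f, hf, hfc⟩ := exists_isRealStable_expApprox (by omega : k ≠ 0) hw hc
    have := isRealStable_or_eq_zero_iff.1 (ha f hf)
    rw [map_diffOp, hfc, map_add, ← smul_eq_C_mul, ← smul_eq_C_mul, map_smul, map_smul] at this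
    rwa [smul_eq_C_mul, smul_eq_C_mul] at this
  rw [complexDiffOp_expApprox hD (by omega)] at hst
  exact Or.inl fun z hz h => hst z hz (by rw [map_mul, h, mul_zero])

end Dichotomy

/-! ### A rigidity lemma in two variables. -/

section Bivariate

open Polynomial in
/-- A polynomial `p(s, t)` vanishing at `t = 0` cannot be such that both `p` and
`κ s p + ∂ₜ p` have, for each small `t`, either no or only zeros `s > 0`. -/
theorem bivariate_eq_zero {p : Polynomial (Polynomial ℂ)} (hp0 : p.coeff 0 = 0) {κ : ℂ}
    (hκ : κ ≠ 0) {δ₀ : ℝ} (hδ₀ : 0 < δ₀)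
    (hp : ∀ t : ℂ, ‖t‖ < δ₀ → (∀ s : ℝ, 0 < s → (p.map (evalRingHom (s : ℂ))).eval t ≠ 0) ∨
      ∀ s : ℝ, 0 < s → (p.map (evalRingHom (s : ℂ))).eval t = 0)
    (hq : ∀ t : ℂ, ‖t‖ < δ₀ →
      (∀ s : ℝ, 0 < s → κ * s * (p.map (evalRingHom (s : ℂ))).eval t +
        (p.map (evalRingHom (s : ℂ))).derivative.eval t ≠ 0) ∨
      ∀ s : ℝ, 0 < s → κ * s * (p.map (evalRingHom (s : ℂ))).eval t +
        (p.map (evalRingHom (s : ℂ))).derivative.eval t = 0) : p = 0 := by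
  by_contra hne
  -- Write `p = t^m Φ` with `Φ(s, 0)` not identically zero and `m = k + 1`. Then `κ s p + ∂ₜp = t^k
  -- Ξ` with `Ξ = (k + 1) Φ + t (κ s Φ + ∂ₜΦ)`.
  obtain ⟨Φ, hΦ, hΦ0⟩ := exists_eq_pow_rootMultiplicity_mul_and_not_dvd p hne 0
  rw [Polynomial.C_0, sub_zero] at hΦ hΦ0
  rw [Polynomial.X_dvd_iff] at hΦ0
  set m := rootMultiplicity 0 p with hm
  have hm0 : m ≠ 0 := by
    intro h
    rw [h, pow_zero, one_mul] at hΦ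
    exact hΦ0 (hΦ ▸ hp0)
  obtain ⟨k, hk⟩ := Nat.exists_eq_succ_of_ne_zero hm0
  rw [hk] at hΦ
  -- `Φ s` and `Ξ s` are the two polynomials in `t`, with the powers of `t` removed
  let Φs : ℝ → Polynomial ℂ := fun s => Φ.map (evalRingHom (s : ℂ))
  let Ξs : ℝ → Polynomial ℂ := fun s =>
    Polynomial.X * (Polynomial.C (κ * s) * Φs s) +
      (Polynomial.C ((k + 1 : ℕ) : ℂ) * Φs s + Polynomial.X * derivative (Φs s))
  have hpΦ : ∀ (s : ℝ) (t : ℂ), (p.map (evalRingHom (s : ℂ))).eval t =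
      t ^ (k + 1) * (Φs s).eval t := by
    intro s t
    rw [hΦ]
    simp [Φs]
  have hqΞ : ∀ (s : ℝ) (t : ℂ), κ * s * (p.map (evalRingHom (s : ℂ))).eval t +
      (p.map (evalRingHom (s : ℂ))).derivative.eval t = t ^ k * (Ξs s).eval t := by
    intro s t
    rw [hΦ]
    simp only [Polynomial.map_mul, Polynomial.map_pow, Polynomial.map_X, derivative_mul,
      derivative_X_pow, Polynomial.eval_add, Polynomial.eval_mul, Polynomial.eval_pow,
      Polynomial.eval_X, Polynomial.eval_C, Φs, Ξs]
    push_cast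
    simp
    ring
  have hΦ0s : ∀ s : ℝ, (Φs s).eval 0 = (Φ.coeff 0).eval (s : ℂ) := by
    intro s
    rw [← coeff_zero_eq_eval_zero, Polynomial.coeff_map, coe_evalRingHom]
  have hlarge : ∀ᶠ s : ℝ in Filter.atTop, (Φs s).eval 0 ≠ 0 := by
    have hfin : {s : ℝ | (Φ.coeff 0).eval (s : ℂ) = 0}.Finite := by
      refine ((Polynomial.finite_setOfPred_isRoot hΦ0).preimage
        (Complex.ofReal_injective.injOn)).subset fun s hs => hs
    obtain ⟨M, hM⟩ := hfin.bddAbove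
    filter_upwards [Filter.eventually_gt_atTop M] with s hs h
    rw [hΦ0s] at h
    exact absurd (hM h) (not_le.2 hs)
  have hΞ0 : ∀ s : ℝ, (Ξs s).eval 0 = (k + 1 : ℕ) * (Φs s).eval 0 := by
    intro s
    simp [Ξs]
  have hkc : ((k + 1 : ℕ) : ℂ) ≠ 0 := by exact_mod_cast k.succ_ne_zero
  obtain ⟨s₁, hs₁, hs₁pos⟩ := (hlarge.and (Filter.eventually_gt_atTop 0)).exists
  -- The radius is chosen at the single value `s₁`. For `t ≠ 0` the dichotomy carries nonvanishing
  -- from `s₁` to all `s > 0`, so `δ` is uniform in `s`.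
  obtain ⟨δ, hδ, hδ₁⟩ : ∃ δ : ℝ, 0 < δ ∧ ∀ t : ℂ, ‖t‖ < δ →
      ‖t‖ < δ₀ ∧ (Φs s₁).eval t ≠ 0 ∧ (Ξs s₁).eval t ≠ 0 := by
    have h1 : ∀ᶠ t : ℂ in nhds 0, ‖t‖ < δ₀ ∧ (Φs s₁).eval t ≠ 0 ∧ (Ξs s₁).eval t ≠ 0 := by
      refine Filter.Eventually.and ?_ (Filter.Eventually.and ?_ ?_)
      · exact (continuous_norm.tendsto (0 : ℂ)).eventually_lt_const (by simpa using hδ₀)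
      · exact (Φs s₁).continuous.continuousAt.eventually_ne hs₁
      · refine (Ξs s₁).continuous.continuousAt.eventually_ne ?_
        rw [hΞ0]
        exact mul_ne_zero hkc hs₁
    obtain ⟨δ, hδ, h⟩ := Metric.eventually_nhds_iff.1 h1
    exact ⟨δ, hδ, fun t ht => h (by simpa using ht)⟩
  have hne0 : ∀ s : ℝ, 0 < s → (Φs s).eval 0 ≠ 0 → ∀ t : ℂ, ‖t‖ < δ →
      (Φs s).eval t ≠ 0 ∧ (Ξs s).eval t ≠ 0 := by
    intro s hs hs0 t ht
    rcases eq_or_ne t 0 with rfl | ht0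
    · refine ⟨hs0, ?_⟩
      rw [hΞ0]
      exact mul_ne_zero hkc hs0
    · obtain ⟨h1, h2, h3⟩ := hδ₁ t ht
      constructor
      · rcases hp t h1 with h | h
        · have := h s hs
          rw [hpΦ] at this
          exact right_ne_zero_of_mul this
        · have := h s₁ hs₁pos
          rw [hpΦ] at this
          exact absurd this (mul_ne_zero (pow_ne_zero _ ht0) h2)
      · rcases hq t h1 with h | h
        · have := h s hs
          rw [hqΞ] at this
          exact right_ne_zero_of_mul this
        · have := h s₁ hs₁pos
          rw [hqΞ] at this
          exact absurd this (mul_ne_zero (pow_ne_zero _ ht0) h3)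
  set D := Φ.natDegree + 1 with hD
  have hdΦ : ∀ s, (Φs s).natDegree ≤ Φ.natDegree := fun s => natDegree_map_le
  have hdΞ : ∀ s, (Ξs s).natDegree ≤ D := by
    intro s
    have h1 : ∀ q : Polynomial ℂ, (Polynomial.X * q).natDegree ≤ q.natDegree + 1 := fun q =>
      natDegree_mul_le.trans (by rw [natDegree_X, add_comm])
    refine natDegree_add_le_of_degree_le ((h1 _).trans (Nat.succ_le_succ ?_))
      (natDegree_add_le_of_degree_le ?_ ((h1 _).trans (Nat.succ_le_succ ?_)))
    · exact (natDegree_C_mul_le _ _).trans (hdΦ s)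
    · exact (natDegree_C_mul_le _ _).trans ((hdΦ s).trans (Nat.le_succ _))
    · exact (natDegree_derivative_le _).trans ((Nat.sub_le _ _).trans (hdΦ s))
  -- At `t = 0` the logarithmic derivatives of `Φ` and `Ξ` are at most `D/δ`, while `∂ₜΞ = κ s Φ +
  -- (k + 2) ∂ₜΦ` there. This bounds `‖κ‖ s`, and `s` is taken beyond that bound.
  obtain ⟨s, ⟨hs0, hspos⟩, hsl⟩ := ((hlarge.and (Filter.eventually_gt_atTop 0)).and
    (Filter.eventually_gt_atTop ((D / δ * (k + 1) + (k + 2) * (D / δ)) / ‖κ‖))).exists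
  have b1 := norm_derivative_eval_zero_le (D := D) hδ ((hdΦ s).trans (Nat.le_succ _))
    fun t ht => (hne0 s hspos hs0 t ht).1
  have b2 := norm_derivative_eval_zero_le hδ (hdΞ s) fun t ht => (hne0 s hspos hs0 t ht).2
  have hΞd : (derivative (Ξs s)).eval 0 =
      κ * s * (Φs s).eval 0 + (k + 2 : ℕ) * (derivative (Φs s)).eval 0 := by
    simp only [Ξs, derivative_add, derivative_mul, derivative_X, derivative_C, Polynomial.eval_add,
      Polynomial.eval_mul,
      Polynomial.eval_X, Polynomial.eval_C, Polynomial.eval_one, Polynomial.eval_zero]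
    push_cast
    ring
  rw [hΞd, hΞ0, norm_mul, Complex.norm_natCast] at b2
  have hκs : ‖κ * s * (Φs s).eval 0‖ ≤
      ‖κ * s * (Φs s).eval 0 + (k + 2 : ℕ) * (derivative (Φs s)).eval 0‖ +
        (k + 2 : ℕ) * ‖(derivative (Φs s)).eval 0‖ := by
    have := norm_sub_le (κ * s * (Φs s).eval 0 + (k + 2 : ℕ) * (derivative (Φs s)).eval 0)
      ((k + 2 : ℕ) * (derivative (Φs s)).eval 0)
    rwa [add_sub_cancel_right, norm_mul ((k + 2 : ℕ) : ℂ), Complex.norm_natCast] at this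
  have hpos : 0 < ‖(Φs s).eval 0‖ := norm_pos_iff.2 hs0
  rw [norm_mul, norm_mul, Complex.norm_real, Real.norm_of_nonneg hspos.le] at hκs
  have b3 : ‖κ‖ * s * ‖(Φs s).eval 0‖ ≤
      (D / δ * (k + 1) + (k + 2) * (D / δ)) * ‖(Φs s).eval 0‖ := by
    refine hκs.trans ((add_le_add b2 (mul_le_mul_of_nonneg_left b1 (Nat.cast_nonneg _))).trans
      (le_of_eq ?_))
    push_cast
    ring
  have b4 := le_of_mul_le_mul_right b3 hpos
  rw [div_lt_iff₀ (norm_pos_iff.2 hκ)] at hsl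
  linarith

end Bivariate

/-! ### Composition of an operator with multiplication by a variable. -/

section Composition

variable {n : ℕ}

/-- The commutation relation of the Weyl algebra. For `b = 0` the truncated exponent `b - 1` is
harmless, since its coefficient `b` is zero. -/
theorem pderiv_pow_X_mul {σ R : Type*} [CommRing R] (j : σ) (b : ℕ) (M : MvPolynomial σ R) :
    ((pderiv j).toLinearMap ^ b : Module.End R (MvPolynomial σ R)) (X j * M) =
      X j * ((pderiv j).toLinearMap ^ b : Module.End R (MvPolynomial σ R)) M +
        (b : R) • ((pderiv j).toLinearMap ^ (b - 1) : Module.End R (MvPolynomial σ R)) M := by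
  induction b with
  | zero => simp
  | succ b ih =>
    rw [pow_succ', Module.End.mul_apply, ih, Module.End.mul_apply, map_add, map_smul,
      Derivation.coeFn_coe, pderiv_mul, pderiv_X_self, one_mul]
    have : (b : R) • pderiv j (((pderiv j).toLinearMap ^ (b - 1) :
        Module.End R (MvPolynomial σ R)) M) =
        (b : R) • ((pderiv j).toLinearMap ^ b : Module.End R (MvPolynomial σ R)) M := by
      rcases b with _ | b
      · simp
      · rw [Nat.add_sub_cancel, pow_succ', Module.End.mul_apply, Derivation.coeFn_coe]
    rw [this, Nat.add_sub_cancel, Nat.cast_succ, add_smul, one_smul]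
    ring

theorem derivList_X_mul {ι R : Type*} [DecidableEq ι] [CommRing R] (b : ι → ℕ) {j : ι} {l : List ι}
    (hl : l.Nodup) (hj : j ∈ l) (M : MvPolynomial ι R) :
    derivList id b l (X j * M) = X j * derivList id b l M +
      (b j : R) • derivList id (b - Pi.single j 1) l M := by
  induction l with
  | nil => simp at hj
  | cons i l ih =>
    rw [List.nodup_cons] at hl
    have hcons : ∀ (b : ι → ℕ) M, derivList id b (i :: l) M =
        ((pderiv i).toLinearMap ^ b i : Module.End R (MvPolynomial ι R))
          (derivList id b l M) := fun b M => by
      simp [derivList]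
    rw [hcons, hcons, hcons]
    by_cases hij : i = j
    · subst hij
      have hne : ∀ k ∈ l, k ≠ i := fun k hk h => hl.1 (h ▸ hk)
      rw [derivList_const_mul (u := id) (fun k hk => pderiv_X_of_ne (hne k hk).symm),
        pderiv_pow_X_mul]
      have : derivList id (b - Pi.single i 1) l M = derivList id b l M := by
        rw [derivList, derivList]
        congr 2
        refine List.map_congr_left fun k hk => ?_
        simp [Pi.single_eq_of_ne (hne k hk)]
      rw [this]
      simp
    · have hjl : j ∈ l := (List.mem_cons.1 hj).resolve_left (Ne.symm hij)
      rw [ih hl.2 hjl, map_add, map_smul, pderiv_pow_const_mul (pderiv_X_of_ne (Ne.symm hij))]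
      simp [Pi.single_eq_of_ne hij]

theorem monomialOp_X_mul (α β : Fin n →₀ ℕ) (j : Fin n) (f : MvPolynomial (Fin n) ℝ) :
    monomialOp α β (X j * f) = monomialOp (α + Finsupp.single j 1) β f +
      (β j : ℝ) • monomialOp α (β - Finsupp.single j 1) f := by
  have h : ∀ (γ : Fin n →₀ ℕ) f, partialPow γ f = derivList id γ (List.finRange n) f :=
    fun _ _ => rfl
  have h2 : ⇑(β - Finsupp.single j 1 : Fin n →₀ ℕ) = ⇑β - Pi.single j 1 := by
    rw [Finsupp.coe_tsub, Finsupp.single_eq_pi_single]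
  simp only [monomialOp, Module.End.mul_apply, LinearMap.mulLeft_apply, h, h2]
  rw [derivList_X_mul _ (List.nodup_finRange n) (List.mem_finRange j), mul_add, mul_smul_comm,
    ← mul_assoc]
  congr 2
  rw [X, monomial_mul, one_mul]

/-- Composition of a differential operator with multiplication by a variable, on symbols. -/
theorem exists_diffOp_eq_comp_X_mul (a : ((Fin n →₀ ℕ) × (Fin n →₀ ℕ)) →₀ ℝ) (j : Fin n) :
    ∃ a', (∀ f, diffOp n a' f = diffOp n a (X j * f)) ∧
      symbolPoly a' = X (Sum.inl j) * symbolPoly a + pderiv (Sum.inr j) (symbolPoly a) := by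
  have hadd : ∀ a b : ((Fin n →₀ ℕ) × (Fin n →₀ ℕ)) →₀ ℝ,
      symbolPoly (a + b) = symbolPoly a + symbolPoly b := fun a b =>
    Finsupp.sum_add_index' (by simp) (by simp)
  have hsingle : ∀ (p : (Fin n →₀ ℕ) × (Fin n →₀ ℕ)) (c : ℝ), symbolPoly (Finsupp.single p c) =
      monomial (Finsupp.sumFinsuppAddEquivProdFinsupp.symm p) (c : ℂ) := fun p c =>
    Finsupp.sum_single_index (by simp)
  induction a using Finsupp.induction_linear with
  | zero => exact ⟨0, by simp, by simp [symbolPoly]⟩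
  | add a b iha ihb =>
    obtain ⟨a', ha, ha'⟩ := iha
    obtain ⟨b', hb, hb'⟩ := ihb
    refine ⟨a' + b', fun f => by simp [ha, hb], ?_⟩
    rw [hadd, hadd, ha', hb', map_add]
    ring
  | single p c =>
    refine ⟨Finsupp.single (p.1 + Finsupp.single j 1, p.2) c +
      Finsupp.single (p.1, p.2 - Finsupp.single j 1) (c * p.2 j), fun f => ?_, ?_⟩
    · simp only [diffOp, map_add, Finsupp.linearCombination_single, LinearMap.add_apply,
        LinearMap.smul_apply, monomialOp_X_mul, smul_add, smul_smul]
    · have h1 : Finsupp.sumFinsuppAddEquivProdFinsupp.symm (p.1 + Finsupp.single j 1, p.2) =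
          Finsupp.single (Sum.inl j) 1 + Finsupp.sumFinsuppAddEquivProdFinsupp.symm p := by
        refine Finsupp.ext fun i => ?_
        rcases i with i | i <;> simp [Finsupp.single_apply, add_comm]
      have h2 : Finsupp.sumFinsuppAddEquivProdFinsupp.symm (p.1, p.2 - Finsupp.single j 1) =
          Finsupp.sumFinsuppAddEquivProdFinsupp.symm p - Finsupp.single (Sum.inr j) 1 := by
        refine Finsupp.ext fun i => ?_
        rcases i with i | i <;> simp [Finsupp.single_apply]
      rw [hadd, hsingle, hsingle, hsingle, X, monomial_mul, pderiv_monomial, one_mul, h1, h2]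
      simp

end Composition

/-! ### Necessity: the symbol of a preserver is stable. -/

section Necessity

variable {n : ℕ}

theorem symbolPoly_injective : Function.Injective (symbolPoly (n := n)) := by
  intro a b h
  ext p
  have hc : ∀ a : ((Fin n →₀ ℕ) × (Fin n →₀ ℕ)) →₀ ℝ,
      coeff (Finsupp.sumFinsuppAddEquivProdFinsupp.symm p) (symbolPoly a) = (a p : ℂ) := by
    intro a
    simp only [symbolPoly, Finsupp.sum, coeff_sum, coeff_monomial,
      EmbeddingLike.apply_eq_iff_eq]
    rw [Finset.sum_ite_eq']
    split_ifs with h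
    · rfl
    · simp [Finsupp.notMem_support_iff.1 h]
  have h1 := hc a
  rw [h, hc b] at h1
  exact_mod_cast h1.symm

theorem symbolEval_dichotomy {a : ((Fin n →₀ ℕ) × (Fin n →₀ ℕ)) →₀ ℝ}
    (ha : ∀ f : MvPolynomial (Fin n) ℝ, IsRealStable f →
      IsRealStable (diffOp n a f) ∨ diffOp n a f = 0)
    {w : Fin n → ℂ} (hw : ∀ i, 0 < (w i).im) :
    (∀ z : Fin n → ℂ, (∀ i, 0 < (z i).im) → symbolEval a z (fun i => -w i) ≠ 0) ∨
      ∀ z, symbolEval a z (fun i => -w i) = 0 := by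
  rcases isStableOrZero_aeval_symbolPoly ha hw with h | h
  · refine Or.inl fun z hz => ?_
    rw [← eval_aeval_symbolPoly]
    exact h z hz
  · refine Or.inr fun z => ?_
    rw [← eval_aeval_symbolPoly, h, map_zero]

/-- The symbol along `z = i s y`, `w = -w₀ + t eⱼ`, as a polynomial in `s` and `t`. -/
def symbolPlane (y : Fin n → ℝ) (w : Fin n → ℂ) (j : Fin n) :
    MvPolynomial (Fin n ⊕ Fin n) ℂ →ₐ[ℂ] Polynomial (Polynomial ℂ) :=
  aeval (Sum.elim (fun i => Polynomial.C (Polynomial.C (y i * Complex.I) * Polynomial.X))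
    fun i => Polynomial.C (Polynomial.C (-w i)) +
      Polynomial.C (Polynomial.C (Pi.single (M := fun _ => ℂ) j 1 i)) * Polynomial.X)

theorem map_symbolPlane (y : Fin n → ℝ) (w : Fin n → ℂ) (j : Fin n)
    (F : MvPolynomial (Fin n ⊕ Fin n) ℂ) (s : ℂ) :
    (symbolPlane y w j F).map (Polynomial.evalRingHom s) =
      lineSlice (Sum.elim (fun i => y i * Complex.I * s) fun i => -w i)
        (Pi.single (Sum.inr j) 1) F := by
  have h : (Polynomial.mapRingHom (Polynomial.evalRingHom s)).comp
      (symbolPlane y w j).toRingHom =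
      (lineSlice (Sum.elim (fun i => y i * Complex.I * s) fun i => -w i)
        (Pi.single (Sum.inr j) 1)).toRingHom := by
    apply MvPolynomial.ringHom_ext
    · intro r
      simp [symbolPlane, lineSlice]
    · rintro (i | i)
      · simp [symbolPlane, lineSlice]
      · by_cases hij : i = j
        · subst hij
          simp [symbolPlane, lineSlice]
        · simp [symbolPlane, lineSlice, Pi.single_eq_of_ne hij,
            Pi.single_eq_of_ne (fun h => hij (Sum.inr_injective h) : Sum.inr i ≠ Sum.inr j)]
  exact congrArg (fun g => g F) h

theorem eval_lineSlice_symbolPoly (a : ((Fin n →₀ ℕ) × (Fin n →₀ ℕ)) →₀ ℝ) (z w : Fin n → ℂ)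
    (j : Fin n) (t : ℂ) :
    (lineSlice (Sum.elim z fun i => -w i) (Pi.single (Sum.inr j) 1) (symbolPoly a)).eval t =
      symbolEval a z (fun i => -(w i - Pi.single (M := fun _ => ℂ) j t i)) := by
  rw [eval_lineSlice, eval_symbolPoly]
  congr 1
  · funext i
    simp
  · funext i
    by_cases hij : i = j
    · subst hij
      simp
      ring
    · simp [Pi.single_eq_of_ne hij,
        Pi.single_eq_of_ne (fun h => hij (Sum.inr_injective h) : Sum.inr i ≠ Sum.inr j)]

/-- Both `T` and `f ↦ T(zⱼ f)` are preservers, so both symbols obey the dichotomy for `w` in the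
upper half-plane. On `z = i s y` they supply the two hypotheses of `bivariate_eq_zero`, with `κ = i
yⱼ`. Only small `t` enters there, but the vanishing of a polynomial then gives all `t`. -/
theorem symbolEval_eq_zero_of_sub_single {a : ((Fin n →₀ ℕ) × (Fin n →₀ ℕ)) →₀ ℝ}
    (ha : ∀ f : MvPolynomial (Fin n) ℝ, IsRealStable f →
      IsRealStable (diffOp n a f) ∨ diffOp n a f = 0)
    {w : Fin n → ℂ} (hw : ∀ i, 0 < (w i).im) (h0 : ∀ z, symbolEval a z (fun i => -w i) = 0)
    (j : Fin n) (t : ℂ) (z : Fin n → ℂ) :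
    symbolEval a z (fun i => -(w i - Pi.single (M := fun _ => ℂ) j t i)) = 0 := by
  obtain ⟨a', ha', hsym⟩ := exists_diffOp_eq_comp_X_mul a j
  have ha'' : ∀ f : MvPolynomial (Fin n) ℝ, IsRealStable f →
      IsRealStable (diffOp n a' f) ∨ diffOp n a' f = 0 := by
    intro f hf
    rw [ha']
    refine ha _ fun x hx => ?_
    rw [map_mul, map_X, map_mul, eval_X]
    refine mul_ne_zero (fun h => ?_) (hf x hx)
    have := hx j
    rw [h] at this
    simp at this
  have hw' : ∀ t : ℂ, ‖t‖ < (w j).im →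
      ∀ i, 0 < (w i - Pi.single (M := fun _ => ℂ) j t i).im := by
    intro t ht i
    by_cases hij : i = j
    · subst hij
      have := (Complex.abs_im_le_norm t).trans_lt ht
      rw [abs_lt] at this
      simp
      linarith
    · simpa [Pi.single_eq_of_ne hij] using hw i
  by_contra hne
  -- The ray is chosen so that the supposedly nonzero polynomial does not vanish at its point `s =
  -- 1`.
  obtain ⟨y, hy, hy0⟩ := exists_pos_eval_mul_I_ne_zero (p := (aeval (Sum.elim X fun i =>
    C (-(w i - Pi.single (M := fun _ => ℂ) j t i))) (symbolPoly a) : MvPolynomial (Fin n) ℂ)) (by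
      intro h
      rw [← eval_aeval_symbolPoly, h, map_zero] at hne
      exact hne rfl)
  rw [eval_aeval_symbolPoly] at hy0
  have hp : ∀ (s : ℝ) (t : ℂ),
      ((symbolPlane y w j (symbolPoly a)).map (Polynomial.evalRingHom (s : ℂ))).eval t =
        symbolEval a (fun i => y i * Complex.I * s)
          (fun i => -(w i - Pi.single (M := fun _ => ℂ) j t i)) := by
    intro s t
    rw [map_symbolPlane, eval_lineSlice_symbolPoly]
  have hq : ∀ (s : ℝ) (t : ℂ), y j * Complex.I * s *
      ((symbolPlane y w j (symbolPoly a)).map (Polynomial.evalRingHom (s : ℂ))).eval t +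
      ((symbolPlane y w j (symbolPoly a)).map (Polynomial.evalRingHom (s : ℂ))).derivative.eval t =
        symbolEval a' (fun i => y i * Complex.I * s)
          (fun i => -(w i - Pi.single (M := fun _ => ℂ) j t i)) := by
    intro s t
    rw [map_symbolPlane, derivative_lineSlice, ← eval_lineSlice_symbolPoly, hsym, map_add, map_mul,
      Polynomial.eval_add, Polynomial.eval_mul]
    congr 2
    simp [lineSlice]
  have hz : ∀ s : ℝ, 0 < s → ∀ i, 0 < (y i * Complex.I * s : ℂ).im := fun s hs i => by
    simpa using mul_pos (hy i) hs
  have hzero : symbolPlane y w j (symbolPoly a) = 0 := by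
    refine bivariate_eq_zero (κ := y j * Complex.I) (δ₀ := (w j).im) ?_ ?_ (hw j) ?_ ?_
    · refine Polynomial.funext fun s => ?_
      have h1 := congrArg (Polynomial.eval 0) (map_symbolPlane y w j (symbolPoly a) s)
      rw [eval_lineSlice_symbolPoly, ← Polynomial.coeff_zero_eq_eval_zero,
        Polynomial.coeff_map, Polynomial.coe_evalRingHom] at h1
      rw [h1, Polynomial.eval_zero]
      simpa using h0 _
    · simpa using (hy j).ne'
    · intro t ht
      simp only [hp]
      rcases symbolEval_dichotomy ha (hw' t ht) with h | h
      · exact Or.inl fun s hs => h _ (hz s hs)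
      · exact Or.inr fun s _ => h _
    · intro t ht
      simp only [hq]
      rcases symbolEval_dichotomy ha'' (hw' t ht) with h | h
      · exact Or.inl fun s hs => h _ (hz s hs)
      · exact Or.inr fun s _ => h _
  have := hp 1 t
  rw [hzero] at this
  simp only [Polynomial.map_zero, Polynomial.eval_zero, Complex.ofReal_one, mul_one] at this
  exact hy0 this.symm

/-- Moving from `w` to any `w'` one coordinate at a time stays in the upper half-plane and keeps
`F(·, -w)` zero. Hence `F` vanishes on a product of infinite sets. -/
theorem eq_zero_of_symbolEval_eq_zero {a : ((Fin n →₀ ℕ) × (Fin n →₀ ℕ)) →₀ ℝ}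
    (ha : ∀ f : MvPolynomial (Fin n) ℝ, IsRealStable f →
      IsRealStable (diffOp n a f) ∨ diffOp n a f = 0)
    {w : Fin n → ℂ} (hw : ∀ i, 0 < (w i).im) (h0 : ∀ z, symbolEval a z (fun i => -w i) = 0) :
    a = 0 := by
  have h1 : ∀ w' : Fin n → ℂ, (∀ i, 0 < (w' i).im) → ∀ z, symbolEval a z (fun i => -w' i) = 0 := by
    intro w' hw'
    have hs : ∀ s : Finset (Fin n), ∀ z, symbolEval a z (fun i => -(s.piecewise w' w) i) = 0 := by
      intro s
      induction s using Finset.induction_on with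
      | empty => simpa using h0
      | insert j s _ ih =>
        intro z
        have hpw : ∀ i, 0 < ((s.piecewise w' w) i).im := by
          intro i
          rw [Finset.piecewise]
          split_ifs
          exacts [hw' i, hw i]
        have h2 := symbolEval_eq_zero_of_sub_single ha hpw ih j
          ((s.piecewise w' w) j - w' j) z
        rw [Finset.piecewise_insert]
        convert h2 using 3 with i
        by_cases hij : i = j
        · subst hij
          simp
        · simp [Pi.single_eq_of_ne hij, Function.update_of_ne hij]
    simpa using hs Finset.univ
  apply symbolPoly_injective
  have h2 : symbolPoly (0 : ((Fin n →₀ ℕ) × (Fin n →₀ ℕ)) →₀ ℝ) = 0 := by simp [symbolPoly]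
  rw [h2]
  refine funext_set (fun _ => {t : ℂ | ∃ y : ℝ, 0 < y ∧ t = -(y * Complex.I)})
    (fun _ => ?_) fun x hx => ?_
  · have := infinite_range_pos_mul_I.image (f := fun t : ℂ => -t) neg_injective.injOn
    refine this.mono ?_
    rintro _ ⟨_, ⟨y, hy, rfl⟩, rfl⟩
    exact ⟨y, hy, rfl⟩
  · rw [map_zero, eval_symbolPoly]
    have h3 := h1 (fun i => -x (Sum.inr i)) (fun i => by
      obtain ⟨y, hy, h⟩ := hx (Sum.inr i) (Set.mem_univ _)
      rw [h]
      simpa using hy) fun i => x (Sum.inl i)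
    simpa using h3

theorem isRealStable_of_mem_realStabilityPreservers {T : weylAlgebra n}
    (hT : T ∈ realStabilityPreservers n) : IsRealStable (negW (symbol T)) := by
  obtain ⟨hT0, hT⟩ := hT
  rw [← diffOp_opCoeff] at hT
  intro x hx
  rw [eval_map_negW_symbol]
  rcases symbolEval_dichotomy hT (w := fun i => x (Sum.inr i)) (fun i => hx _) with h | h
  · exact h _ fun i => hx _
  · exfalso
    apply hT0
    have := eq_zero_of_symbolEval_eq_zero hT (fun i => hx _) h
    apply Subtype.ext
    rw [← diffOp_opCoeff, this, map_zero, ZeroMemClass.coe_zero]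

end Necessity

end StabilityPreservers

end

theorem theorem1p3 (n : ℕ) (T : StabilityPreservers.weylAlgebra n) :
    T ∈ StabilityPreservers.realStabilityPreservers n ↔
      StabilityPreservers.IsRealStable
        (StabilityPreservers.negW (StabilityPreservers.symbol T)) :=
  ⟨StabilityPreservers.isRealStable_of_mem_realStabilityPreservers,
    StabilityPreservers.mem_realStabilityPreservers_of_isRealStable⟩
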